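/- Let $\theta\neq 2$ be a Pisot number, that is, a real algebraic integer $\theta>1$ all of whose other conjugates are less than $1$ in modulus. Let $\mu_\theta$ be the Bernoulli convolution with parameter $\theta$, i.e. the infinite convolution over $k\ge 0$ of the measures $\frac12\delta_{-\theta^{-k}}+\frac12\delta_{\theta^{-k}}$ on $\mathbb R$ (equivalently, the law of the random series $\sum_{k\ge0}\pm\theta^{-k}$ with independent fair signs), and let $\widehat{\mu_\theta}(t)=\int e^{-2\pi i t x}\,d\mu_\theta(x)=\prod_{k\ge0}\cos(2\pi\theta^{-k}t)$ be its Fourier transform. For $r>0$ put $\mathcal F_{\mu_\theta,r}=\{\widehat{\mu_\theta}(rn): n\in\mathbb Z\}$. For a set $E$ let $E'$ be its derived set, that is, the set of its limit (accumulation) points, and put $E^{(1)}=E'$, $E^{(n+1)}=(E^{(n)})'$. Then for every positive $r\in\mathbb Q(\theta)$ and every $n\ge1$, the set $\mathcal F_{\mu_\theta,r}^{(n)}$ is countably infinite, i.e. it is countable and it is infinite. -/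

import Mathlib

open MeasureTheory Topology
open scoped ENNReal IntermediateField

/-- A Pisot number: a real algebraic integer greater than `1`, all of whose other (complex)
conjugates, i.e. the other complex roots of its minimal polynomial over `ℚ`, are of modulus
less than `1`. -/
def IsPisot (θ : ℝ) : Prop :=
  IsIntegral ℤ θ ∧ 1 < θ ∧
    ∀ z : ℂ, Polynomial.aeval z (minpoly ℚ θ) = 0 → z ≠ (θ : ℂ) → ‖z‖ < 1

/-- The law of a fair coin. -/
noncomputable def fairCoin : Measure Bool :=
  (2⁻¹ : ℝ≥0∞) • Measure.dirac false + (2⁻¹ : ℝ≥0∞) • Measure.dirac true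

instance : IsProbabilityMeasure fairCoin :=
  ⟨by simp [fairCoin, ENNReal.inv_two_add_inv_two]⟩

/-- The sign attached to the outcome of a coin toss. -/
def coinSign (b : Bool) : ℝ := if b then 1 else -1

/-- The Bernoulli convolution `μ_θ`, `θ > 1`: the infinite convolution over `k ≥ 0` of the
measures `½ δ_{-θ^{-k}} + ½ δ_{θ^{-k}}`, that is, the law of the random series `∑ k, ± θ^{-k}`
whose signs are chosen independently with equal probabilities. -/
noncomputable def bernoulliConvolution (θ : ℝ) : Measure ℝ :=
  (Measure.infinitePi fun _ : ℕ => fairCoin).map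
    fun ε => ∑' k : ℕ, coinSign (ε k) * θ⁻¹ ^ k

/-- The Fourier transform `t ↦ ∫ e^{-2πitx} dν(x)` of a measure on the line. -/
noncomputable def fourierTransform (ν : Measure ℝ) (t : ℝ) : ℂ :=
  ∫ x, Complex.exp (-2 * Real.pi * Complex.I * t * x) ∂ν

/-- The set `{ν̂(r n) : n ∈ ℤ}`. -/
def fourierCoeffSet (ν : Measure ℝ) (r : ℝ) : Set ℂ :=
  Set.range fun n : ℤ => fourierTransform ν (r * n)

/-- The `n`-th derived set of `E`: `E^{(0)} = E` and `E^{(n+1)} = (E^{(n)})'`, where `E'` is the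
set of accumulation points of `E`. -/
def iteratedDerivedSet {X : Type*} [TopologicalSpace X] (n : ℕ) (E : Set X) : Set X :=
  derivedSet^[n] E

/-! Independence of the signs gives `cosProduct` as the Fourier transform, so everything concerns
the values of `cosProduct θ` at `r * n`. Infinitude and countability have separate proofs.

Infinitude. If `β ∈ ℤ[θ]`, then `β θ^k` is summably close to integers (for `k → ∞` by the Pisot
property), so the two-sided product `biCosProduct θ β` converges. It is the limit of `cosProduct θ
(β θ^N)`, and also of values at multiples of `r` when `β / r ∈ ℤ[θ]`. Since `β` and `γ θ^W` decouple
as `W → ∞` (`tendsto_biCosProduct_add`), these limits generate a closed multiplicative semigroup. A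
suitable integer `b` gives a nonzero product; this is where `θ ≠ 2` enters. The values at `b ± b
θ^W` tend to its square without both being equal to it, so the square is a nonzero accumulation
point. By `pow_mem_iteratedDerivedSet` its powers lie in the iterated derived sets; each of these is
infinite because the next is nonempty.

Countability. All derived sets lie in the closure, which is shown to be countable. For `t = 2 r n`,
let `ε k` be the signed distance of `t θ^k` to the nearest integer, `k ≤ 0`. The recurrence of the
minimal polynomial maps `ε` to integers away from the cut at `0`. If the product stays away from
`0`, only boundedly many of these integers are nonzero, and hyperbolicity (no conjugate on the unit
circle) makes `ε` decay exponentially away from their positions. Along an ultrafilter the positions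
form clusters drifting apart, and the limit is a product over local limits of `ε`. A local limit is
determined by finitely supported integer data; at the cut one real parameter remains, and `r ∈ ℚ(θ)`
pins it down by one more integer. -/

open Filter

/-! ### The Fourier transform as a cosine product -/

lemma measurable_coinSign : Measurable coinSign := measurable_of_finite _

lemma abs_coinSign (b : Bool) : |coinSign b| = 1 := by
  cases b <;> simp [coinSign]

lemma summable_coinSign_mul {θ : ℝ} (hθ : 1 < θ) (ε : ℕ → Bool) :
    Summable fun k => coinSign (ε k) * θ⁻¹ ^ k := by
  have h0 : 0 < θ⁻¹ := by positivity
  refine Summable.of_norm_bounded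
    (summable_geometric_of_lt_one h0.le (inv_lt_one_of_one_lt₀ hθ)) fun k => ?_
  rw [norm_mul, Real.norm_eq_abs, abs_coinSign, one_mul, Real.norm_of_nonneg (by positivity)]

/-- The product `∏ k, cos (2π t θ^{-k})`. -/
noncomputable def cosProduct (θ t : ℝ) : ℝ :=
  ∏' k : ℕ, Real.cos (2 * Real.pi * (t * θ⁻¹ ^ k))

lemma multipliable_cos {ι : Type*} {x : ι → ℝ} (hx : Summable fun i => |x i|) :
    Multipliable fun i => Real.cos (x i) := by
  have := multipliable_one_add_of_summable (f := fun i => Real.cos (x i) - 1) ?_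
  · simpa using this
  · refine Summable.of_nonneg_of_le (fun _ => norm_nonneg _) (fun i => ?_) hx
    simpa using Real.abs_cos_sub_cos_le (x i) 0

lemma summable_abs_mul_inv_pow {θ : ℝ} (hθ : 1 < θ) (c t : ℝ) :
    Summable fun k : ℕ => |c * (t * θ⁻¹ ^ k)| := by
  have h0 : 0 < θ⁻¹ := by positivity
  exact (((summable_geometric_of_lt_one h0.le (inv_lt_one_of_one_lt₀ hθ)).mul_left t).mul_left c).abs

lemma hasProd_cosProduct {θ : ℝ} (hθ : 1 < θ) (t : ℝ) :
    HasProd (fun k : ℕ => Real.cos (2 * Real.pi * (t * θ⁻¹ ^ k))) (cosProduct θ t) :=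
  (multipliable_cos (summable_abs_mul_inv_pow hθ _ t)).hasProd

lemma integral_fairCoin (f : Bool → ℂ) : ∫ b, f b ∂fairCoin = (f false + f true) / 2 := by
  have h (b : Bool) : IsFiniteMeasure ((2⁻¹ : ℝ≥0∞) • Measure.dirac b) :=
    Measure.smul_finite _ (by simp)
  have := h false
  have := h true
  rw [fairCoin, integral_add_measure Integrable.of_finite Integrable.of_finite]
  simp
  ring

/-- For the partial sums of the random series, independence factors the integral into averages of
two conjugate exponentials, which are cosines. The integrands have modulus `1`, so dominated
convergence passes to the limit. -/
lemma fourierTransform_bernoulliConvolution {θ : ℝ} (hθ : 1 < θ) (t : ℝ) :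
    fourierTransform (bernoulliConvolution θ) t = cosProduct θ t := by
  set φ : ℝ → ℂ := fun x => Complex.exp (-2 * Real.pi * Complex.I * t * x) with hφ
  have hφc : Continuous φ := by fun_prop
  have hφn (x : ℝ) : ‖φ x‖ = 1 := by
    rw [hφ, Complex.norm_exp]; simp
  have hmeas : Measurable fun ε : ℕ → Bool => ∑' k : ℕ, coinSign (ε k) * θ⁻¹ ^ k := by
    refine measurable_of_tendsto_metrizable
      (f := fun K (ε : ℕ → Bool) => ∑ k ∈ Finset.range K, coinSign (ε k) * θ⁻¹ ^ k) (fun K => ?_) ?_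
    · refine Finset.measurable_fun_sum _ fun k _ => ?_
      exact (measurable_coinSign.comp (measurable_pi_apply k)).mul_const _
    · rw [tendsto_pi_nhds]
      exact fun ε => (summable_coinSign_mul hθ ε).hasSum.tendsto_sum_nat
  have key : Tendsto (fun K : ℕ => ∫ ε, φ (∑ k ∈ Finset.range K, coinSign (ε k) * θ⁻¹ ^ k)
      ∂(Measure.infinitePi fun _ : ℕ => fairCoin)) atTop
      (𝓝 (fourierTransform (bernoulliConvolution θ) t)) := by
    rw [fourierTransform, bernoulliConvolution, integral_map hmeas.aemeasurable
      hφc.aestronglyMeasurable]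
    refine tendsto_integral_of_dominated_convergence (fun _ => 1) (fun K => ?_)
      (integrable_const _) (fun K => ?_) ?_
    · refine (hφc.measurable.comp ?_).aestronglyMeasurable
      refine Finset.measurable_fun_sum _ fun k _ => ?_
      exact (measurable_coinSign.comp (measurable_pi_apply k)).mul_const _
    · exact Eventually.of_forall fun ε => (hφn _).le
    · exact Eventually.of_forall fun ε =>
        (hφc.tendsto _).comp (summable_coinSign_mul hθ ε).hasSum.tendsto_sum_nat
  have hprod (K : ℕ) : ∫ ε, φ (∑ k ∈ Finset.range K, coinSign (ε k) * θ⁻¹ ^ k)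
      ∂(Measure.infinitePi fun _ : ℕ => fairCoin)
      = ((∏ k ∈ Finset.range K, Real.cos (2 * Real.pi * (t * θ⁻¹ ^ k)) : ℝ) : ℂ) := by
    have hind := (ProbabilityTheory.iIndepFun_infinitePi (P := fun _ : ℕ => fairCoin)
      (X := fun _ b => b) (fun _ => measurable_id)).precomp
      (Fin.val_injective (n := K))
    have h := hind.integral_fun_prod_comp
      (f := fun (i : Fin K) (b : Bool) => φ (coinSign b * θ⁻¹ ^ (i : ℕ)))
      (fun i => (measurable_pi_apply (i : ℕ)).aemeasurable)
      (fun i => (measurable_of_finite _).aestronglyMeasurable)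
    have hφsum (ε : ℕ → Bool) : φ (∑ k ∈ Finset.range K, coinSign (ε k) * θ⁻¹ ^ k)
        = ∏ i : Fin K, φ (coinSign (ε i) * θ⁻¹ ^ (i : ℕ)) := by
      simp only [hφ]
      rw [← Complex.exp_sum, ← Finset.mul_sum, Finset.sum_range, Complex.ofReal_sum]
    simp_rw [hφsum]
    refine h.trans ?_
    rw [Finset.prod_range, Complex.ofReal_prod]
    refine Finset.prod_congr rfl fun i _ => ?_
    have h2 : ∫ ε : ℕ → Bool, φ (coinSign (ε i) * θ⁻¹ ^ (i : ℕ))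
        ∂(Measure.infinitePi fun _ : ℕ => fairCoin)
        = ∫ b, φ (coinSign b * θ⁻¹ ^ (i : ℕ)) ∂fairCoin := by
      conv_rhs => rw [← Measure.infinitePi_map_eval (fun _ : ℕ => fairCoin) (i : ℕ)]
      rw [integral_map (measurable_pi_apply _).aemeasurable
        (measurable_of_finite _).aestronglyMeasurable]
    rw [h2, integral_fairCoin, Complex.ofReal_cos, Complex.cos]
    simp only [hφ, coinSign]
    push_cast
    congr 3 <;> simp <;> ring_nf
  simp_rw [hprod] at key
  exact tendsto_nhds_unique key
    ((Complex.continuous_ofReal.tendsto _).comp (hasProd_cosProduct hθ t).tendsto_prod_nat)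

/-- The real version of the set of Fourier coefficients. -/
def cosProductSet (θ r : ℝ) : Set ℝ := Set.range fun n : ℤ => cosProduct θ (r * n)

lemma fourierCoeffSet_bernoulliConvolution {θ : ℝ} (hθ : 1 < θ) (r : ℝ) :
    fourierCoeffSet (bernoulliConvolution θ) r = Complex.ofReal '' cosProductSet θ r := by
  rw [fourierCoeffSet, cosProductSet, ← Set.range_comp]
  congr 1
  ext n
  simp [fourierTransform_bernoulliConvolution hθ]

/-! ### Powers of a Pisot number and nearby integers -/

lemma exists_int_eq_sum_embeddings_pow {K : Type*} [Field K] [Algebra ℚ K]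
    [FiniteDimensional ℚ K] {g : K}
    (hg : IsIntegral ℤ g) (k : ℕ) : ∃ T : ℤ, (T : ℂ) = ∑ σ : K →ₐ[ℚ] ℂ, σ g ^ k := by
  obtain ⟨T, hT⟩ := IsIntegrallyClosed.isIntegral_iff.1
    (Algebra.isIntegral_trace (L := ℚ) (hg.pow k))
  refine ⟨T, ?_⟩
  have := trace_eq_sum_embeddings ℂ (K := ℚ) (x := g ^ k)
  rw [← hT] at this
  simpa using this

/-- The integer `T k` is the trace of `g ^ k`; what separates it from `σ₀ g ^ k` is a sum of `k`-th
powers of conjugates inside the unit disc. -/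
lemma exists_summable_norm_embedding_pow_sub {K : Type*} [Field K] [Algebra ℚ K]
    [FiniteDimensional ℚ K] {g : K}
    (hg : IsIntegral ℤ g) (σ₀ : K →ₐ[ℚ] ℂ) (hσ₀ : ∀ σ : K →ₐ[ℚ] ℂ, σ ≠ σ₀ → ‖σ g‖ < 1) :
    ∃ T : ℕ → ℤ, Summable fun k => ‖σ₀ g ^ k - T k‖ := by
  classical
  choose T hT using exists_int_eq_sum_embeddings_pow hg
  have hsum : Summable fun k : ℕ => ∑ σ ∈ Finset.univ.erase σ₀, ‖σ g‖ ^ k := by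
    refine summable_sum fun σ hσ => summable_geometric_of_lt_one (norm_nonneg _) (hσ₀ σ ?_)
    exact (Finset.mem_erase.1 hσ).1
  refine ⟨T, hsum.of_nonneg_of_le (fun _ => norm_nonneg _) fun k => ?_⟩
  rw [hT k, ← Finset.add_sum_erase _ _ (Finset.mem_univ σ₀), sub_add_cancel_left, norm_neg]
  refine (norm_sum_le _ _).trans (Finset.sum_le_sum fun σ _ => ?_)
  exact (norm_pow (σ g) k).le

/-- The powers of a Pisot number are summably close to the integers. -/
lemma IsPisot.exists_summable_sub_pow {θ : ℝ} (hθ : IsPisot θ) :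
    ∃ T : ℕ → ℤ, Summable fun k => |θ ^ k - T k| := by
  have hint : IsIntegral ℚ θ := hθ.1.tower_top
  have : FiniteDimensional ℚ ℚ⟮θ⟯ := IntermediateField.adjoin.finiteDimensional hint
  obtain ⟨pb, hpb⟩ : ∃ pb : PowerBasis ℚ ℚ⟮θ⟯, (pb.gen : ℝ) = θ :=
    ⟨IntermediateField.adjoin.powerBasis hint, by
      rw [IntermediateField.adjoin.powerBasis_gen]; rfl⟩
  have hmin : minpoly ℚ pb.gen = minpoly ℚ θ := by
    rw [← minpoly.algebraMap_eq (algebraMap ℚ⟮θ⟯ ℝ).injective]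
    exact congrArg _ hpb
  have hgi : IsIntegral ℤ pb.gen := by
    rw [← isIntegral_algebraMap_iff (algebraMap ℚ⟮θ⟯ ℝ).injective]
    exact (congrArg (IsIntegral ℤ) hpb).mpr hθ.1
  have hσ₀ : (Complex.ofRealAm.restrictScalars ℚ).comp (ℚ⟮θ⟯.val) pb.gen = θ :=
    congrArg Complex.ofReal hpb
  generalize (Complex.ofRealAm.restrictScalars ℚ).comp (ℚ⟮θ⟯.val) = σ₀ at hσ₀
  obtain ⟨T, hT⟩ := exists_summable_norm_embedding_pow_sub hgi σ₀ fun σ hσ => by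
    refine hθ.2.2 _ ?_ fun h => hσ (pb.algHom_ext (h.trans hσ₀.symm))
    rw [← hmin, Polynomial.aeval_algHom_apply, minpoly.aeval, map_zero]
  refine ⟨T, hT.congr fun k => ?_⟩
  rw [hσ₀, ← Real.norm_eq_abs, ← Complex.norm_real]
  push_cast
  rfl

/-- `β θ^k` is summably close to the integers, as `k` runs through the integers. -/
def NearIntegerOrbit (θ β : ℝ) : Prop :=
  ∃ T : ℤ → ℤ, Summable fun k : ℤ => |β * θ ^ k - T k|

lemma IsPisot.exists_summable_sub_aeval {θ : ℝ} (hθ : IsPisot θ) (p : Polynomial ℤ) :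
    ∃ T : ℕ → ℤ, Summable fun k => |Polynomial.aeval θ p * θ ^ k - T k| := by
  induction p using Polynomial.induction_on' with
  | add p q hp hq =>
    obtain ⟨T, hT⟩ := hp
    obtain ⟨U, hU⟩ := hq
    refine ⟨T + U, (hT.add hU).of_nonneg_of_le (fun _ => abs_nonneg _) fun k => ?_⟩
    refine le_trans (le_of_eq ?_) (abs_add_le _ _)
    congr 1
    simp; ring
  | monomial n a =>
    obtain ⟨T, hT⟩ := hθ.exists_summable_sub_pow
    refine ⟨fun k => a * T (k + n), (((summable_nat_add_iff n).2 hT).mul_left |(a : ℝ)|).congr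
      fun k => ?_⟩
    rw [← abs_mul]
    congr 1
    simp; ring

lemma IsPisot.nearIntegerOrbit {θ : ℝ} (hθ : IsPisot θ) (p : Polynomial ℤ) :
    NearIntegerOrbit θ (Polynomial.aeval θ p) := by
  obtain ⟨T, hT⟩ := hθ.exists_summable_sub_aeval p
  have h1 : 1 < θ := hθ.2.1
  have h0 : 0 < θ := by linarith
  -- For negative `k` the nearby integer is `0`, as `θ ^ k` itself decays geometrically.
  refine ⟨fun k => if 0 ≤ k then T k.toNat else 0, Summable.of_nat_of_neg_add_one ?_ ?_⟩
  · simpa using hT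
  · have := (summable_abs_mul_inv_pow h1 1 (Polynomial.aeval θ p * θ⁻¹))
    refine this.congr fun k => ?_
    have : ¬ (0 : ℤ) ≤ -(k + 1) := by lia
    simp only [if_neg this]
    have : θ ^ (-((k : ℤ) + 1)) = θ⁻¹ * θ⁻¹ ^ k := by
      rw [zpow_neg, zpow_add₀ h0.ne']; simp [mul_comm]
    rw [this]
    congr 1
    push_cast; ring

/-! ### Two-sided cosine products and their limits -/

/-- The two-sided product `∏ k : ℤ, cos (2π β θ^k)`. -/
noncomputable def biCosProduct (θ β : ℝ) : ℝ := ∏' k : ℤ, Real.cos (2 * Real.pi * (β * θ ^ k))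

lemma cos_two_pi_mul_sub_int (x : ℝ) (n : ℤ) :
    Real.cos (2 * Real.pi * (x - n)) = Real.cos (2 * Real.pi * x) := by
  rw [← Real.cos_sub_int_mul_two_pi (2 * Real.pi * x) n]; congr 1; ring

lemma sin_two_pi_mul_sub_int (x : ℝ) (n : ℤ) :
    Real.sin (2 * Real.pi * (x - n)) = Real.sin (2 * Real.pi * x) := by
  rw [← Real.sin_sub_int_mul_two_pi (2 * Real.pi * x) n]; congr 1; ring

lemma NearIntegerOrbit.summable_cos_sub_one {θ β : ℝ} (h : NearIntegerOrbit θ β) :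
    Summable fun k : ℤ => ‖Real.cos (2 * Real.pi * (β * θ ^ k)) - 1‖ := by
  obtain ⟨T, hT⟩ := h
  refine Summable.of_nonneg_of_le (fun _ => norm_nonneg _) (fun k => ?_)
    (hT.mul_left (2 * Real.pi))
  rw [← cos_two_pi_mul_sub_int _ (T k)]
  have := Real.abs_cos_sub_cos_le (2 * Real.pi * (β * θ ^ k - T k)) 0
  rwa [Real.cos_zero, sub_zero, abs_mul (2 * Real.pi), abs_of_pos Real.two_pi_pos] at this

lemma NearIntegerOrbit.summable_sin {θ β : ℝ} (h : NearIntegerOrbit θ β) :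
    Summable fun k : ℤ => |Real.sin (2 * Real.pi * (β * θ ^ k))| := by
  obtain ⟨T, hT⟩ := h
  refine Summable.of_nonneg_of_le (fun _ => abs_nonneg _) (fun k => ?_)
    (hT.mul_left (2 * Real.pi))
  rw [← sin_two_pi_mul_sub_int _ (T k)]
  refine Real.abs_sin_le_abs.trans_eq ?_
  rw [abs_mul (2 * Real.pi), abs_of_pos Real.two_pi_pos]

lemma NearIntegerOrbit.multipliable {θ β : ℝ} (h : NearIntegerOrbit θ β) :
    Multipliable fun k : ℤ => Real.cos (2 * Real.pi * (β * θ ^ k)) := by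
  simpa using multipliable_one_add_of_summable h.summable_cos_sub_one

lemma NearIntegerOrbit.biCosProduct_ne_zero {θ β : ℝ} (h : NearIntegerOrbit θ β)
    (h0 : ∀ k : ℤ, Real.cos (2 * Real.pi * (β * θ ^ k)) ≠ 0) : biCosProduct θ β ≠ 0 := by
  have := tprod_one_add_ne_zero_of_summable
    (f := fun k : ℤ => Real.cos (2 * Real.pi * (β * θ ^ k)) - 1)
    (by simpa using h0) h.summable_cos_sub_one
  simpa [biCosProduct] using this

lemma abs_prod_sub_prod_le {ι : Type*} (s : Finset ι) {a b : ι → ℝ}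
    (ha : ∀ i, |a i| ≤ 1) (hb : ∀ i, |b i| ≤ 1) :
    |∏ i ∈ s, a i - ∏ i ∈ s, b i| ≤ ∑ i ∈ s, |a i - b i| := by
  classical
  induction s using Finset.induction_on with
  | empty => simp
  | insert i s hi ih =>
    rw [Finset.prod_insert hi, Finset.prod_insert hi, Finset.sum_insert hi]
    have h1 : |∏ i ∈ s, b i| ≤ 1 := by
      rw [Finset.abs_prod]; exact Finset.prod_le_one (fun _ _ => abs_nonneg _) fun j _ => hb j
    calc |a i * ∏ i ∈ s, a i - b i * ∏ i ∈ s, b i|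
        = |(a i - b i) * ∏ i ∈ s, b i + a i * (∏ i ∈ s, a i - ∏ i ∈ s, b i)| := by
          congr 1; ring
      _ ≤ |a i - b i| * |∏ i ∈ s, b i| + |a i| * |∏ i ∈ s, a i - ∏ i ∈ s, b i| := by
          rw [← abs_mul, ← abs_mul]; exact abs_add_le _ _
      _ ≤ |a i - b i| * 1 + 1 * ∑ i ∈ s, |a i - b i| := by
          gcongr; exact ha i
      _ = _ := by ring

lemma abs_hasProd_sub_hasProd_le {ι : Type*} {a b c : ι → ℝ} {A B : ℝ}
    (ha : ∀ i, |a i| ≤ 1) (hb : ∀ i, |b i| ≤ 1) (hA : HasProd a A) (hB : HasProd b B)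
    (hc : Summable c) (habc : ∀ i, |a i - b i| ≤ c i) : |A - B| ≤ ∑' i, c i := by
  have h : Filter.Tendsto (fun s => |∏ i ∈ s, a i - ∏ i ∈ s, b i|) Filter.atTop (𝓝 |A - B|) :=
    (Filter.Tendsto.sub hA hB).abs
  refine le_of_tendsto' h fun s => (abs_prod_sub_prod_le s ha hb).trans ?_
  exact (Finset.sum_le_sum fun i _ => habc i).trans
    (hc.sum_le_tsum s fun i _ => (abs_nonneg _).trans (habc i))

lemma abs_cosProduct_sub_le {θ : ℝ} (hθ : 1 < θ) (s t : ℝ) :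
    |cosProduct θ s - cosProduct θ t| ≤ |s - t| * ∑' k : ℕ, 2 * Real.pi * θ⁻¹ ^ k := by
  have h0 : 0 < θ⁻¹ := by positivity
  rw [← tsum_mul_left]
  refine abs_hasProd_sub_hasProd_le (fun _ => Real.abs_cos_le_one _)
    (fun _ => Real.abs_cos_le_one _) (hasProd_cosProduct hθ s) (hasProd_cosProduct hθ t)
    (((summable_geometric_of_lt_one h0.le (inv_lt_one_of_one_lt₀ hθ)).mul_left _).mul_left _)
    fun k => (Real.abs_cos_sub_cos_le _ _).trans_eq ?_
  rw [← mul_sub, ← sub_mul, abs_mul (2 * Real.pi), abs_mul (s - t), abs_of_pos Real.two_pi_pos,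
    abs_of_pos (pow_pos h0 k)]
  ring

lemma tendsto_cosProduct_mul_pow {θ β : ℝ} (hθ : 1 < θ) (h : NearIntegerOrbit θ β) :
    Tendsto (fun N : ℕ => cosProduct θ (β * θ ^ N)) atTop (𝓝 (biCosProduct θ β)) := by
  have h0 : θ ≠ 0 := by positivity
  set u : ℤ → ℝ := fun k => Real.cos (2 * Real.pi * (β * θ ^ k)) with hu
  have key := tendsto_tprod_one_add_of_dominated_convergence (𝓕 := atTop)
    (f := fun (N : ℕ) (k : ℤ) => if k ≤ N then u k - 1 else 0) (g := fun k => u k - 1)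
    h.summable_cos_sub_one (fun k => ?_) ?_
  · have e2 : biCosProduct θ β = ∏' k : ℤ, (1 + (u k - 1)) := by simp [biCosProduct, hu]
    rw [e2]
    refine key.congr fun N => ?_
    -- The one-sided product at `β * θ ^ N` is the two-sided product with the factors of index above
    -- `N` replaced by `1`, read backwards from `N`.
    have hinj : Function.Injective fun k : ℕ => (N : ℤ) - k := fun a b hab => by
      simpa using hab
    rw [← hinj.tprod_eq]
    · rw [cosProduct]
      refine tprod_congr fun k => ?_
      have : (N : ℤ) - k ≤ N := by lia
      rw [if_pos this, add_sub_cancel, hu]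
      simp only
      rw [zpow_sub₀ h0, inv_pow, mul_assoc β, zpow_natCast, zpow_natCast, div_eq_mul_inv]
    · intro k hk
      have hk' : k ≤ N := by
        by_contra hcon
        simp [hcon] at hk
      exact ⟨(N - k).toNat, by simp only; lia⟩
  · refine tendsto_const_nhds.congr' ?_
    filter_upwards [eventually_ge_atTop k.toNat] with N hN
    rw [if_pos (by lia)]
  · refine Eventually.of_forall fun N k => ?_
    split_ifs
    · exact le_rfl
    · simp

/-- The argument `β θ^N` differs from `r * T N` by a quantity tending to `0`, and `cosProduct` is
Lipschitz. -/
lemma biCosProduct_mem_closure {θ r β : ℝ} (hθ : 1 < θ) (hr : r ≠ 0) (h : NearIntegerOrbit θ β)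
    (h' : NearIntegerOrbit θ (β / r)) : biCosProduct θ β ∈ closure (cosProductSet θ r) := by
  obtain ⟨T, hT⟩ := h'
  have hT0 : Tendsto (fun N : ℕ => |β / r * θ ^ N - T N|) atTop (𝓝 0) := by
    have := hT.tendsto_cofinite_zero.comp
      (Nat.cofinite_eq_atTop ▸ (Nat.cast_injective (R := ℤ)).tendsto_cofinite)
    simpa [Function.comp_def] using this
  have h1 : Tendsto (fun N : ℕ => cosProduct θ (r * T N) - cosProduct θ (β * θ ^ N)) atTop
      (𝓝 0) := by
    refine squeeze_zero_norm (a := fun N : ℕ => |r| * |β / r * θ ^ N - T N| *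
      ∑' k : ℕ, 2 * Real.pi * θ⁻¹ ^ k) (fun N => ?_) ?_
    · refine (abs_cosProduct_sub_le hθ _ _).trans_eq ?_
      rw [← abs_mul, abs_sub_comm]
      congr 2
      field_simp
    · simpa using (hT0.const_mul |r|).mul_const (∑' k : ℕ, 2 * Real.pi * θ⁻¹ ^ k)
  have h2 := h1.add (tendsto_cosProduct_mul_pow hθ h)
  simp only [sub_add_cancel, zero_add] at h2
  exact mem_closure_of_tendsto h2 (Eventually.of_forall fun N => ⟨T N, rfl⟩)

lemma biCosProduct_mul_zpow {θ : ℝ} (hθ : θ ≠ 0) (β : ℝ) (W : ℤ) :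
    biCosProduct θ (β * θ ^ W) = biCosProduct θ β := by
  rw [biCosProduct, biCosProduct,
    ← (Equiv.addRight W).tprod_eq fun k => Real.cos (2 * Real.pi * (β * θ ^ k))]
  refine tprod_congr fun k => ?_
  simp only [Equiv.coe_addRight]
  rw [add_comm k W, zpow_add₀ hθ]
  congr 2
  ring

lemma NearIntegerOrbit.mul_zpow {θ β : ℝ} (hθ : θ ≠ 0) (h : NearIntegerOrbit θ β) (W : ℤ) :
    NearIntegerOrbit θ (β * θ ^ W) := by
  obtain ⟨T, hT⟩ := h
  refine ⟨fun k => T (k + W), ((Equiv.addRight W).summable_iff.2 hT).congr fun k => ?_⟩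
  simp only [Function.comp_apply, Equiv.coe_addRight]
  rw [add_comm k W, zpow_add₀ hθ]
  congr 1
  ring

lemma NearIntegerOrbit.add {θ β γ : ℝ} (h : NearIntegerOrbit θ β) (h' : NearIntegerOrbit θ γ) :
    NearIntegerOrbit θ (β + γ) := by
  obtain ⟨T, hT⟩ := h
  obtain ⟨U, hU⟩ := h'
  refine ⟨T + U, (hT.add hU).of_nonneg_of_le (fun _ => abs_nonneg _) fun k => ?_⟩
  refine le_trans (le_of_eq ?_) (abs_add_le _ _)
  congr 1
  simp; ring

lemma NearIntegerOrbit.neg {θ β : ℝ} (h : NearIntegerOrbit θ β) :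
    NearIntegerOrbit θ (-β) := by
  obtain ⟨T, hT⟩ := h
  refine ⟨fun k => -T k, hT.congr fun k => ?_⟩
  rw [← abs_neg]
  congr 1
  push_cast; ring

/-- By the addition formula the factors of the two sides differ by `sin x_k * sin y_{k+W}`. Both
sine sequences are summable, so the sum of these errors vanishes as the shift `W` grows. -/
lemma tendsto_biCosProduct_add {θ β γ : ℝ} (hθ : θ ≠ 0) (h : NearIntegerOrbit θ β)
    (h' : NearIntegerOrbit θ γ) :
    Tendsto (fun W : ℕ => biCosProduct θ (β + γ * θ ^ W)) atTop
      (𝓝 (biCosProduct θ β * biCosProduct θ γ)) := by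
  set x : ℤ → ℝ := fun k => 2 * Real.pi * (β * θ ^ k) with hx
  set y : ℤ → ℝ := fun k => 2 * Real.pi * (γ * θ ^ k) with hy
  have hsx : Summable fun k => |Real.sin (x k)| := h.summable_sin
  have hsy : Summable fun k => |Real.sin (y k)| := h'.summable_sin
  have hsum (W : ℕ) : Summable fun k => |Real.sin (x k)| * |Real.sin (y (k + W))| :=
    hsx.of_nonneg_of_le (fun _ => by positivity) fun k =>
      mul_le_of_le_one_right (abs_nonneg _) (Real.abs_sin_le_one _)
  have hlim : Tendsto (fun W : ℕ => ∑' k, |Real.sin (x k)| * |Real.sin (y (k + W))|) atTop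
      (𝓝 (∑' _ : ℤ, 0)) := by
    refine tendsto_tsum_of_dominated_convergence hsx (fun k => ?_)
      (Eventually.of_forall fun W k => ?_)
    · have : Tendsto (fun W : ℕ => |Real.sin (y (k + W))|) atTop (𝓝 0) := by
        have hinj : Function.Injective fun W : ℕ => k + (W : ℤ) := fun a b hab => by
          simpa using hab
        exact hsy.tendsto_cofinite_zero.comp (Nat.cofinite_eq_atTop ▸ hinj.tendsto_cofinite)
      simpa using this.const_mul |Real.sin (x k)|
    · rw [Real.norm_of_nonneg (by positivity)]
      exact mul_le_of_le_one_right (abs_nonneg _) (Real.abs_sin_le_one _)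
  rw [tsum_zero] at hlim
  rw [tendsto_iff_dist_tendsto_zero]
  refine squeeze_zero (fun _ => dist_nonneg) (fun W => ?_) hlim
  rw [Real.dist_eq, ← biCosProduct_mul_zpow hθ γ W]
  have hW := h'.mul_zpow hθ W
  have e (k : ℤ) : 2 * Real.pi * (γ * θ ^ (W : ℤ) * θ ^ k) = y (k + W) := by
    rw [hy]; simp only; rw [add_comm, zpow_add₀ hθ]; ring
  have hab := (h.add hW).multipliable.hasProd
  have hm : HasProd (fun k => Real.cos (x k) * Real.cos (y (k + W)))
      (biCosProduct θ β * biCosProduct θ (γ * θ ^ (W : ℤ))) := by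
    have := h.multipliable.hasProd.mul hW.multipliable.hasProd
    rw [← biCosProduct, ← biCosProduct] at this
    simpa only [e] using this
  rw [← zpow_natCast]
  refine abs_hasProd_sub_hasProd_le (fun _ => Real.abs_cos_le_one _) (fun k => ?_) hab hm
    (hsum W) fun k => ?_
  · rw [abs_mul]
    exact mul_le_one₀ (Real.abs_cos_le_one _) (abs_nonneg _) (Real.abs_cos_le_one _)
  · rw [add_mul, mul_add, e, Real.cos_add, sub_sub_cancel_left, abs_neg, abs_mul]

/-! ### Arithmetic: avoiding zeros of the cosines -/

/-- Elements of `ℚ(θ)` are values at `θ` of integer polynomials of small degree, up to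
an integer factor. -/
lemma exists_int_polynomial_aeval_eq {θ : ℝ} (hθ : IsIntegral ℤ θ) {y : ℝ} (hy : y ∈ ℚ⟮θ⟯) :
    ∃ (q : ℕ) (p : Polynomial ℤ), 0 < q ∧ p.natDegree < (minpoly ℤ θ).natDegree ∧
      Polynomial.aeval θ p = q * y := by
  have hint : IsIntegral ℚ θ := hθ.tower_top
  have hmon := minpoly.monic hint
  rw [← IntermediateField.mem_toSubalgebra,
    IntermediateField.adjoin_simple_toSubalgebra_of_isAlgebraic hint.isAlgebraic,
    Algebra.adjoin_singleton_eq_range_aeval] at hy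
  obtain ⟨P, hP⟩ := hy
  have hdeg : (minpoly ℚ θ).natDegree = (minpoly ℤ θ).natDegree := by
    rw [minpoly.isIntegrallyClosed_eq_field_fractions' ℚ hθ, (minpoly.monic hθ).natDegree_map]
  have hQ : Polynomial.aeval θ (P %ₘ minpoly ℚ θ) = y := by
    rw [Polynomial.aeval_modByMonic_eq_self_of_root (minpoly.aeval ℚ θ)]
    exact hP
  have hQd : (P %ₘ minpoly ℚ θ).natDegree < (minpoly ℤ θ).natDegree := by
    rw [← hdeg]
    exact Polynomial.natDegree_modByMonic_lt _ hmon fun h => minpoly.ne_one ℚ θ h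
  obtain ⟨b, hb0, hb⟩ := IsLocalization.integerNormalization_spec (nonZeroDivisors ℤ)
    (P %ₘ minpoly ℚ θ)
  set R := IsLocalization.integerNormalization (nonZeroDivisors ℤ) (P %ₘ minpoly ℚ θ)
  have hb0 : b ≠ 0 := nonZeroDivisors.ne_zero hb0
  have hR : Polynomial.aeval θ R = b * y := by
    rw [← Polynomial.aeval_map_algebraMap ℚ, hb, map_zsmul, hQ, zsmul_eq_mul]
  -- The denominator `b` may be negative; multiplying once more by `b` makes the factor positive.
  refine ⟨(b * b).toNat, b • R, ?_, ?_, ?_⟩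
  · have := mul_self_pos.2 hb0
    lia
  · refine lt_of_le_of_lt (Polynomial.natDegree_smul_le _ _) ?_
    rw [← Polynomial.natDegree_map_eq_of_injective (algebraMap ℤ ℚ).injective_int, hb]
    exact lt_of_le_of_lt (Polynomial.natDegree_smul_le _ _) hQd
  · have h2 : (((b * b).toNat : ℤ) : ℝ) = ((b * b : ℤ) : ℝ) := by
      rw [Int.toNat_of_nonneg (mul_self_nonneg b)]
    rw [Int.cast_natCast] at h2
    rw [map_zsmul, hR, h2, zsmul_eq_mul]
    push_cast
    ring

/-- Every conjugate is a root of `X ^ j - q`, hence has modulus `θ > 1`. So there is no other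
conjugate, and `θ` is a rational algebraic integer. -/
lemma IsPisot.exists_nat_eq {θ : ℝ} (hθ : IsPisot θ) {j : ℕ} (hj : j ≠ 0) {q : ℚ}
    (hq : θ ^ j = q) : ∃ m : ℕ, θ = m := by
  have hint : IsIntegral ℚ θ := hθ.1.tower_top
  have h1 := hθ.2.1
  have hroot (z : ℂ) (hz : Polynomial.aeval z (minpoly ℚ θ) = 0) : z = θ := by
    by_contra hne
    have hdvd : minpoly ℚ θ ∣ Polynomial.X ^ j - Polynomial.C q :=
      minpoly.dvd _ _ (by simp [hq])
    have h2 : z ^ j = q := by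
      have := Polynomial.aeval_eq_zero_of_dvd_aeval_eq_zero hdvd hz
      simpa [sub_eq_zero] using this
    have h3 : ‖z‖ ^ j = θ ^ j := by
      have h4 : ((θ ^ j : ℝ) : ℂ) = q := by rw [hq]; simp
      rw [← norm_pow, h2, ← h4, Complex.norm_real, Real.norm_of_nonneg (by positivity)]
    have h5 := (pow_left_inj₀ (norm_nonneg z) (by linarith) hj).1 h3
    linarith [hθ.2.2 z hz hne]
  have hsep : (minpoly ℚ θ).Separable := (minpoly.irreducible hint).separable
  have hcard : (minpoly ℚ θ).natDegree ≤ 1 := by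
    rw [(Polynomial.natDegree_map (algebraMap ℚ ℂ)).symm,
      (IsAlgClosed.splits ((minpoly ℚ θ).map (algebraMap ℚ ℂ))).natDegree_eq_card_roots]
    have hnd := Polynomial.nodup_roots (hsep.map (f := algebraMap ℚ ℂ))
    have hle : ((minpoly ℚ θ).map (algebraMap ℚ ℂ)).roots ≤ {(θ : ℂ)} := by
      refine (Multiset.le_iff_subset hnd).2 fun z hz => ?_
      rw [Multiset.mem_singleton]
      refine hroot z ?_
      have := Polynomial.isRoot_of_mem_roots hz
      rwa [Polynomial.IsRoot, Polynomial.eval_map_algebraMap] at this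
    simpa using Multiset.card_le_card hle
  have hd1 : (minpoly ℚ θ).natDegree = 1 :=
    le_antisymm hcard (minpoly.natDegree_pos hint)
  obtain ⟨q', hq'⟩ := minpoly.natDegree_eq_one_iff.1 hd1
  have hq'i : IsIntegral ℤ q' := by
    rw [← isIntegral_algebraMap_iff (algebraMap ℚ ℝ).injective, hq']; exact hθ.1
  obtain ⟨n, hn⟩ := IsIntegrallyClosed.isIntegral_iff.1 hq'i
  have hθn : θ = n := by rw [← hq', ← hn]; simp
  refine ⟨n.toNat, ?_⟩
  have : 0 ≤ n := by
    have : (0 : ℝ) < n := by rw [← hθn]; linarith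
    exact_mod_cast this.le
  rw [hθn]
  exact_mod_cast (Int.toNat_of_nonneg this).symm

/-- If `m ≥ 3` then some `4 N 2^s` is not an odd multiple of a power of `m`. -/
lemma exists_forall_four_mul_ne_odd_mul_pow {m N : ℕ} (hm : 3 ≤ m) (hN : 0 < N) :
    ∃ s : ℕ, ∀ a j : ℕ, Odd a → 4 * (N * 2 ^ s) ≠ a * m ^ j := by
  by_contra! hcon
  obtain ⟨v, u, hu, hmu⟩ := Nat.exists_eq_two_pow_mul_odd (n := m) (by lia)
  obtain ⟨A, w, hw, hNw⟩ := Nat.exists_eq_two_pow_mul_odd (n := 4 * N) (by lia)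
  have hval (x y : ℕ) (i i' : ℕ) (hx : Odd x) (hy : Odd y) (h : 2 ^ i * x = 2 ^ i' * y) :
      i = i' ∧ x = y := by
    have key (x y i i' : ℕ) (hx : Odd x) (h : 2 ^ i * x = 2 ^ i' * y) : i' ≤ i := by
      refine (Nat.pow_dvd_pow_iff_le_right (x := 2) (by norm_num)).1 ?_
      exact (Nat.Coprime.pow_left _ hx.coprime_two_left).dvd_of_dvd_mul_right ⟨y, h⟩
    have e := le_antisymm (key y x i' i hy h.symm) (key x y i i' hx h)
    subst e
    exact ⟨rfl, Nat.eq_of_mul_eq_mul_left (by positivity) h⟩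
  have main (s : ℕ) : ∃ a j : ℕ, A + s = v * j ∧ w = a * u ^ j := by
    obtain ⟨a, j, ha, h⟩ := hcon s
    refine ⟨a, j, hval w (a * u ^ j) _ _ hw (ha.mul hu.pow) ?_⟩
    calc 2 ^ (A + s) * w = (2 ^ A * w) * 2 ^ s := by ring
      _ = 4 * (N * 2 ^ s) := by rw [← hNw]; ring
      _ = a * m ^ j := h
      _ = _ := by rw [hmu, mul_pow, pow_mul]; ring
  -- Both `A` and `A + 1` are multiples of `v`. Then `m = 2 u` with `u ≥ 3` odd, and `s = w` forces
  -- `j ≥ w` although `u ^ j` divides `w`.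
  have hv : v = 1 := by
    obtain ⟨-, j, h0, -⟩ := main 0
    obtain ⟨-, i, h1, -⟩ := main 1
    have : v ∣ 1 := (Nat.dvd_add_right ⟨j, h0⟩).1 ⟨i, h1⟩
    exact Nat.dvd_one.1 this
  subst hv
  have hu1 : 1 < u := by lia
  obtain ⟨a, j, h0, h1⟩ := main w
  have hw0 := hw.pos
  have h2 : u ^ j ≤ w := Nat.le_of_dvd hw0 ⟨a, by rw [h1]; ring⟩
  have h3 := Nat.lt_pow_self (n := j) hu1
  lia

/-- A cosine vanishes only if `4 N 2^s θ^k` is an odd integer. If no positive power of `θ` is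
rational, this leaves `k = 0`, where the number is even. Otherwise `θ` is an integer `m ≥ 3`, and a
suitable `s` exists; for `m = 2` it would not. -/
lemma IsPisot.exists_forall_cos_ne_zero {θ : ℝ} (hθ : IsPisot θ) (hθ2 : θ ≠ 2) {N : ℕ}
    (hN : 0 < N) : ∃ s : ℕ, ∀ k : ℤ, Real.cos (2 * Real.pi * ((N * 2 ^ s : ℕ) * θ ^ k)) ≠ 0 := by
  have h1 := hθ.2.1
  have h0 : θ ≠ 0 := by linarith
  suffices h : ∃ s : ℕ, ∀ k m : ℤ, ((4 * (N * 2 ^ s) : ℕ) : ℝ) * θ ^ k ≠ 2 * m + 1 by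
    obtain ⟨s, hs⟩ := h
    refine ⟨s, fun k hk => ?_⟩
    obtain ⟨m, hm⟩ := Real.cos_eq_zero_iff.1 hk
    refine hs k m ?_
    have : Real.pi * (((4 * (N * 2 ^ s) : ℕ) : ℝ) * θ ^ k) = Real.pi * (2 * m + 1) := by
      push_cast at hm ⊢
      linarith
    exact mul_left_cancel₀ Real.pi_ne_zero this
  have hodd (a m : ℤ) : (4 * a : ℝ) ≠ 2 * m + 1 := fun h => by
    have : 4 * a = 2 * m + 1 := by exact_mod_cast h
    lia
  by_cases hrat : ∃ (j : ℕ) (q : ℚ), j ≠ 0 ∧ θ ^ j = q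
  · obtain ⟨j, q, hj, hq⟩ := hrat
    obtain ⟨m, rfl⟩ := hθ.exists_nat_eq hj hq
    have hm3 : 3 ≤ m := by
      have : 1 < m := by exact_mod_cast h1
      have : m ≠ 2 := by rintro rfl; simp at hθ2
      lia
    obtain ⟨s, hs⟩ := exists_forall_four_mul_ne_odd_mul_pow hm3 hN
    refine ⟨s, fun k i h => ?_⟩
    obtain ⟨n, rfl | rfl⟩ := k.eq_nat_or_neg
    · refine hodd (N * 2 ^ s * m ^ n) i ?_
      rw [← h]
      push_cast
      rw [zpow_natCast]
      ring
    · rw [zpow_neg, zpow_natCast, ← div_eq_mul_inv, div_eq_iff (by positivity)] at h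
      have h2 : ((4 * (N * 2 ^ s) : ℕ) : ℤ) = (2 * i + 1) * (m : ℤ) ^ n := by exact_mod_cast h
      refine hs (2 * i + 1).natAbs n ?_ ?_
      · rw [Int.natAbs_odd]; exact ⟨i, rfl⟩
      · have := congrArg Int.natAbs h2
        simpa [Int.natAbs_mul, Int.natAbs_pow] using this
  · push Not at hrat
    refine ⟨0, fun k i h => ?_⟩
    have hi : (2 * i + 1 : ℝ) ≠ 0 := by
      have : 2 * i + 1 ≠ 0 := by lia
      exact_mod_cast this
    have hN' : (N : ℝ) ≠ 0 := by positivity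
    obtain ⟨n, rfl | rfl⟩ := k.eq_nat_or_neg
    · rcases eq_or_ne n 0 with rfl | hn
      · refine hodd N i ?_
        rw [← h]; push_cast; simp
      · refine hrat n ((2 * i + 1) / (4 * N)) hn ?_
        push_cast at h ⊢
        rw [zpow_natCast] at h
        rw [← h]; field_simp
    · rcases eq_or_ne n 0 with rfl | hn
      · refine hodd N i ?_
        rw [← h]; push_cast; simp
      · refine hrat n ((4 * N) / (2 * i + 1)) hn ?_
        push_cast at h ⊢
        rw [zpow_neg, zpow_natCast] at h
        rw [← h]; field_simp

/-! ### Iterated derived sets of a multiplicative semigroup -/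

lemma mul_mem_iteratedDerivedSet {K : Set ℝ} (hK : ∀ x ∈ K, ∀ y ∈ K, x * y ∈ K) {c : ℝ}
    (hc : c ∈ K) (hc0 : c ≠ 0) (n : ℕ) {y : ℝ} (hy : y ∈ iteratedDerivedSet n K) :
    c * y ∈ iteratedDerivedSet n K := by
  induction n generalizing y with
  | zero => exact hK c hc y hy
  | succ n ih =>
    rw [iteratedDerivedSet, Function.iterate_succ_apply'] at hy ⊢
    refine derivedSet_mono _ _ ?_ ((continuous_const_mul c).image_derivedSet
      (mul_right_injective₀ hc0) ⟨y, hy, rfl⟩)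
    rintro _ ⟨z, hz, rfl⟩
    exact ih hz

/-- A nonzero accumulation point of a closed multiplicative semigroup of reals yields points in all
iterated derived sets. -/
lemma pow_mem_iteratedDerivedSet {K : Set ℝ} (hK : ∀ x ∈ K, ∀ y ∈ K, x * y ∈ K) {x : ℝ}
    (hx : x ∈ derivedSet K) (hx0 : x ≠ 0) (n : ℕ) :
    x ^ (n + 1) ∈ iteratedDerivedSet (n + 1) K := by
  induction n with
  | zero => simpa [iteratedDerivedSet] using hx
  | succ n ih =>
    rw [iteratedDerivedSet, Function.iterate_succ_apply']
    -- Zero is discarded because only multiplication by a nonzero `z` is injective and so preserves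
    -- the iterated derived sets.
    have h1 : x ∈ derivedSet (K \ {0}) := by
      rw [mem_derivedSet, accPt_iff_frequently] at hx ⊢
      refine (hx.and_eventually (isOpen_ne.mem_nhds hx0)).mono fun z hz => ?_
      exact ⟨hz.1.1, hz.1.2, hz.2⟩
    rw [pow_succ']
    refine derivedSet_mono _ _ ?_ ((continuous_mul_const (x ^ (n + 1))).image_derivedSet
      (mul_left_injective₀ (pow_ne_zero _ hx0)) ⟨x, h1, rfl⟩)
    rintro _ ⟨z, hz, rfl⟩
    exact mul_mem_iteratedDerivedSet hK hz.1 hz.2 _ ih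

lemma iteratedDerivedSet_mono {X : Type*} [TopologicalSpace X] (n : ℕ) {A B : Set X}
    (h : A ⊆ B) : iteratedDerivedSet n A ⊆ iteratedDerivedSet n B := by
  induction n with
  | zero => exact h
  | succ n ih =>
    rw [iteratedDerivedSet, iteratedDerivedSet, Function.iterate_succ_apply',
      Function.iterate_succ_apply']
    exact derivedSet_mono _ _ ih

lemma iteratedDerivedSet_closure {X : Type*} [TopologicalSpace X] [T1Space X] (n : ℕ) (A : Set X) :
    iteratedDerivedSet (n + 1) (closure A) = iteratedDerivedSet (n + 1) A := by
  rw [iteratedDerivedSet, iteratedDerivedSet, Function.iterate_succ_apply,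
    Function.iterate_succ_apply, derivedSet_closure]

lemma iteratedDerivedSet_subset_closure {X : Type*} [TopologicalSpace X] [T1Space X] (n : ℕ)
    (A : Set X) : iteratedDerivedSet n A ⊆ closure A := by
  induction n with
  | zero => exact subset_closure
  | succ n ih =>
    rw [iteratedDerivedSet, Function.iterate_succ_apply']
    exact (derivedSet_mono _ _ ih).trans ((derivedSet_subset_closure _).trans_eq closure_closure)

lemma image_iteratedDerivedSet_subset {X Y : Type*} [TopologicalSpace X] [TopologicalSpace Y]
    {f : X → Y} (hf : Continuous f) (hf' : Function.Injective f) (n : ℕ) (A : Set X) :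
    f '' iteratedDerivedSet n A ⊆ iteratedDerivedSet n (f '' A) := by
  induction n with
  | zero => exact subset_rfl
  | succ n ih =>
    rw [iteratedDerivedSet, iteratedDerivedSet, Function.iterate_succ_apply',
      Function.iterate_succ_apply']
    exact (hf.image_derivedSet hf').trans (derivedSet_mono _ _ ih)

lemma infinite_iteratedDerivedSet_of_nonempty_succ {X : Type*} [TopologicalSpace X] [T1Space X]
    {n : ℕ} {A : Set X} (h : (iteratedDerivedSet (n + 1) A).Nonempty) :
    (iteratedDerivedSet n A).Infinite := by
  rw [iteratedDerivedSet, Function.iterate_succ_apply'] at h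
  obtain ⟨x, hx⟩ := h
  intro hfin
  have hx' : AccPt x (𝓟 (derivedSet^[n] A)) := hx
  rw [accPt_iff_frequently] at hx'
  have : IsClosed (derivedSet^[n] A \ {x}) := (hfin.subset Set.sdiff_subset).isClosed
  have hev : ∀ᶠ y in 𝓝 x, y ∈ (derivedSet^[n] A \ {x})ᶜ := this.isOpen_compl.mem_nhds (by simp)
  exact hx' (hev.mono fun y hy h => hy ⟨h.2, h.1⟩)

/-! ### A nonzero accumulation point -/

lemma lt_of_hasProd_lt {ι : Type*} {u v : ι → ℝ} {U V : ℝ} (hu : HasProd u U) (hv : HasProd v V)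
    (hv0 : ∀ i, 0 ≤ v i) (huv : ∀ i, v i ≤ u i) {i₀ : ι} (hi₀ : v i₀ < u i₀) (hU : U ≠ 0) :
    V < U := by
  classical
  have hu0 (i : ι) : 0 ≤ u i := (hv0 i).trans (huv i)
  have hU0 : 0 < U := lt_of_le_of_ne (ge_of_tendsto' hu fun s => Finset.prod_nonneg fun i _ => hu0 i)
    hU.symm
  have hpos : 0 < u i₀ := (hv0 i₀).trans_lt hi₀
  have hle : V ≤ v i₀ / u i₀ * U := by
    refine le_of_tendsto_of_tendsto hv (hu.const_mul (v i₀ / u i₀)) ?_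
    filter_upwards [eventually_ge_atTop {i₀}] with s hs
    have hs' : i₀ ∈ s := by simpa using hs
    rw [← Finset.mul_prod_erase _ v hs', ← Finset.mul_prod_erase _ u hs', ← mul_assoc,
      div_mul_cancel₀ _ hpos.ne']
    exact mul_le_mul_of_nonneg_left (Finset.prod_le_prod (fun i _ => hv0 i) fun i _ => huv i)
      (hv0 i₀)
  refine hle.trans_lt ?_
  exact mul_lt_of_lt_one_left hU0 ((div_lt_one hpos).2 hi₀)

/-- A product exceeding `1` needs both factors bounded away from `0`, hence both indices in one
finite window, which is impossible for large `W`. It is applied to `|tan|`. -/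
lemma eventually_forall_mul_add_le_one {t : ℤ → ℝ} (ht0 : ∀ k, 0 ≤ t k)
    (ht : Tendsto t cofinite (𝓝 0)) : ∀ᶠ W : ℕ in atTop, ∀ k, t k * t (k + W) ≤ 1 := by
  obtain ⟨B, hB⟩ := ht.bddAbove_range_of_cofinite
  have hB' (k : ℤ) : t k ≤ B := hB ⟨k, rfl⟩
  have hB0 : 0 ≤ B := (ht0 0).trans (hB' 0)
  have hfin : {k | ¬ t k < 1 / (B + 1)}.Finite :=
    ht.eventually_lt_const (show (0 : ℝ) < 1 / (B + 1) by positivity)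
  obtain ⟨R, hR⟩ := (hfin.image fun k => |k|).bddAbove
  filter_upwards [eventually_gt_atTop (2 * R).toNat] with W hW k
  have key (a b : ℝ) (ha0 : 0 ≤ a) (hb : b ≤ B) (ha : a < 1 / (B + 1)) : a * b ≤ 1 := by
    rw [lt_div_iff₀ (by positivity)] at ha
    nlinarith
  by_cases h1 : t k < 1 / (B + 1)
  · exact key _ _ (ht0 _) (hB' _) h1
  by_cases h2 : t (k + W) < 1 / (B + 1)
  · rw [mul_comm]; exact key _ _ (ht0 _) (hB' _) h2
  have e1 : |k| ≤ R := hR ⟨k, h1, rfl⟩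
  have e2 : |k + W| ≤ R := hR ⟨k + W, h2, rfl⟩
  rw [abs_le] at e1 e2
  lia

/-- Some of the values at `b ± b θ^W` differ from their limit. -/
lemma eventually_biCosProduct_ne_or_ne {θ b : ℝ} (hθ : 1 < θ) (hb : 0 < b)
    (h : NearIntegerOrbit θ b) (h0 : ∀ k : ℤ, Real.cos (2 * Real.pi * (b * θ ^ k)) ≠ 0) :
    ∀ᶠ W : ℕ in atTop, biCosProduct θ (b + b * θ ^ W) ≠ biCosProduct θ b * biCosProduct θ b ∨
      biCosProduct θ (b + -b * θ ^ W) ≠ biCosProduct θ b * biCosProduct θ b := by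
  have hθ0 : θ ≠ 0 := by positivity
  set x : ℤ → ℝ := fun k => 2 * Real.pi * (b * θ ^ k) with hx
  have htan : Tendsto (fun k => |Real.tan (x k)|) cofinite (𝓝 0) := by
    have h1 : Tendsto (fun k => Real.cos (x k)) cofinite (𝓝 1) := by
      have := (tendsto_zero_iff_norm_tendsto_zero.2
        h.summable_cos_sub_one.tendsto_cofinite_zero).add_const 1
      simpa using this
    have h2 := h.summable_sin.tendsto_cofinite_zero.div h1.abs (by simp)
    rw [zero_div] at h2
    exact h2.congr fun k => by
      rw [Real.tan_eq_sin_div_cos, abs_div, Pi.div_apply]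
  filter_upwards [eventually_forall_mul_add_le_one (fun k => abs_nonneg _) htan] with W hW
  by_contra! hcon
  have hbW := h.mul_zpow hθ0 W
  have e (k : ℤ) : 2 * Real.pi * (b * θ ^ (W : ℤ) * θ ^ k) = x (k + W) := by
    rw [hx]; simp only; rw [add_comm k, zpow_add₀ hθ0]; ring
  have hP : HasProd (fun k => Real.cos (x k)) (biCosProduct θ b) := h.multipliable.hasProd
  have hPW : HasProd (fun k => Real.cos (x (k + W))) (biCosProduct θ b) := by
    have := hbW.multipliable.hasProd
    rw [← biCosProduct, biCosProduct_mul_zpow hθ0] at this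
    simpa only [e] using this
  have hadd : HasProd (fun k => Real.cos (x k + x (k + W))) (biCosProduct θ (b + b * θ ^ W)) := by
    have := (h.add hbW).multipliable.hasProd
    rw [← biCosProduct] at this
    have e2 (k : ℤ) : 2 * Real.pi * ((b + b * θ ^ (W : ℤ)) * θ ^ k) = x k + x (k + W) := by
      rw [← e]; simp only [hx]; ring
    simp only [e2] at this
    rw [← zpow_natCast]
    exact this
  have hsub : HasProd (fun k => Real.cos (x k - x (k + W)))
      (biCosProduct θ (b + -b * θ ^ W)) := by
    have := (h.add hbW.neg).multipliable.hasProd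
    rw [← biCosProduct] at this
    have e3 (k : ℤ) : 2 * Real.pi * ((b + -(b * θ ^ (W : ℤ))) * θ ^ k) = x k - x (k + W) := by
      rw [← e]; simp only [hx]; ring
    simp only [e3] at this
    rw [neg_mul, ← zpow_natCast]
    exact this
  -- Under `hcon` the products `hP4` and `hPv` have the same value. Yet `cos (x + y) cos (x - y) =
  -- cos² x cos² y - sin² x sin² y` is factorwise at most `cos² x cos² y`, nonnegative by `hW`, and
  -- once strictly smaller.
  have hP4 := (hP.mul hPW).mul (hP.mul hPW)
  have hPv := hadd.mul hsub
  rw [hcon.1, hcon.2] at hPv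
  have hne : biCosProduct θ b ≠ 0 := h.biCosProduct_ne_zero h0
  have hle (k : ℤ) : (Real.sin (x k) * Real.sin (x (k + W))) ^ 2 ≤
      (Real.cos (x k) * Real.cos (x (k + W))) ^ 2 := by
    have h1 : |Real.cos (x k) * Real.cos (x (k + W))| ≠ 0 :=
      abs_ne_zero.2 (mul_ne_zero (h0 k) (h0 (k + W)))
    have h2 := hW k
    rw [Real.tan_eq_sin_div_cos, Real.tan_eq_sin_div_cos, ← abs_mul, div_mul_div_comm, abs_div,
      div_le_one (lt_of_le_of_ne (abs_nonneg _) h1.symm)] at h2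
    exact sq_le_sq.2 h2
  have hform (k : ℤ) : Real.cos (x k + x (k + W)) * Real.cos (x k - x (k + W)) =
      (Real.cos (x k) * Real.cos (x (k + W))) ^ 2 -
        (Real.sin (x k) * Real.sin (x (k + W))) ^ 2 := by
    rw [Real.cos_add, Real.cos_sub]; ring
  -- Far to the left both `x k` and `x (k + W)` lie in `(0, π)`.
  obtain ⟨k₀, hk₀, hk₀'⟩ : ∃ k : ℤ, Real.sin (x k) ≠ 0 ∧ Real.sin (x (k + W)) ≠ 0 := by
    have hpos (k : ℤ) : 0 < x k := by simp only [hx]; positivity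
    obtain ⟨n, hn⟩ := exists_pow_lt_of_lt_one (show 0 < 1 / (2 * b * θ ^ W) by positivity)
      (inv_lt_one_of_one_lt₀ hθ)
    have h1 : x (-n + W) < Real.pi := by
      simp only [hx]
      rw [zpow_add₀ hθ0, zpow_neg, zpow_natCast, zpow_natCast, ← inv_pow]
      rw [lt_div_iff₀ (by positivity)] at hn
      nlinarith [Real.pi_pos]
    have h2 : x (-n) ≤ x (-n + W) := by
      simp only [hx]
      gcongr
      · exact hθ.le
      · lia
    exact ⟨-n, (Real.sin_pos_of_pos_of_lt_pi (hpos _) (h2.trans_lt h1)).ne',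
      (Real.sin_pos_of_pos_of_lt_pi (hpos _) h1).ne'⟩
  have := lt_of_hasProd_lt hP4 hPv (fun k => ?_) (fun k => ?_) (i₀ := k₀) ?_ (by positivity)
  · exact lt_irrefl _ this
  · rw [hform]; linarith [hle k]
  · rw [hform]; nlinarith [sq_nonneg (Real.sin (x k) * Real.sin (x (k + W)))]
  · rw [hform]
    have : 0 < (Real.sin (x k₀) * Real.sin (x (k₀ + W))) ^ 2 := by positivity
    nlinarith

/-- All iterated derived sets are nonempty. -/
lemma IsPisot.nonempty_iteratedDerivedSet {θ : ℝ} (hθ : IsPisot θ) (hθ2 : θ ≠ 2) {r : ℝ}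
    (hr : r ≠ 0) (hrθ : r ∈ ℚ⟮θ⟯) (n : ℕ) :
    (iteratedDerivedSet (n + 1) (cosProductSet θ r)).Nonempty := by
  have h1 := hθ.2.1
  have hθ0 : θ ≠ 0 := by positivity
  -- `N` clears the denominator of `r⁻¹`, so that `b / r` lies in `ℤ[θ]`.
  obtain ⟨N, p, hN, -, hp⟩ := exists_int_polynomial_aeval_eq hθ.1 (inv_mem hrθ)
  obtain ⟨s, hs⟩ := hθ.exists_forall_cos_ne_zero hθ2 hN
  set b : ℝ := ((N * 2 ^ s : ℕ) : ℝ) with hb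
  have hb0 : 0 < b := by rw [hb]; positivity
  let Γ : Set ℝ := Set.range fun P : Polynomial ℤ => biCosProduct θ (b * Polynomial.aeval θ P)
  have hbi (P : Polynomial ℤ) : NearIntegerOrbit θ (b * Polynomial.aeval θ P) := by
    have := hθ.nearIntegerOrbit (((N * 2 ^ s : ℕ) : Polynomial ℤ) * P)
    rwa [map_mul, map_natCast] at this
  have hmulΓ (P Q : Polynomial ℤ) : Tendsto (fun W : ℕ => biCosProduct θ
      (b * Polynomial.aeval θ (P + Q * Polynomial.X ^ W))) atTop
      (𝓝 (biCosProduct θ (b * Polynomial.aeval θ P) * biCosProduct θ (b * Polynomial.aeval θ Q))) := by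
    refine (tendsto_biCosProduct_add hθ0 (hbi P) (hbi Q)).congr fun W => ?_
    simp [mul_add, mul_assoc]
  have hK : ∀ x ∈ closure Γ, ∀ y ∈ closure Γ, x * y ∈ closure Γ := by
    intro x hx y hy
    rw [← closure_closure]
    refine map_mem_closure₂ continuous_mul hx hy ?_
    rintro _ ⟨P, rfl⟩ _ ⟨Q, rfl⟩
    exact mem_closure_of_tendsto (hmulΓ P Q) (Eventually.of_forall fun W => ⟨_, rfl⟩)
  have hsub : closure Γ ⊆ closure (cosProductSet θ r) := by
    refine closure_minimal ?_ isClosed_closure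
    rintro _ ⟨P, rfl⟩
    refine biCosProduct_mem_closure h1 hr (hbi P) ?_
    have := hθ.nearIntegerOrbit (((2 ^ s : ℕ) : Polynomial ℤ) * p * P)
    rw [map_mul, map_mul, map_natCast, hp] at this
    convert this using 1
    rw [hb]; push_cast; field_simp
  have hb1 : NearIntegerOrbit θ b := by simpa using hbi 1
  have hacc : biCosProduct θ b * biCosProduct θ b ∈ derivedSet (closure Γ) := by
    rw [mem_derivedSet, accPt_iff_frequently]
    intro hev
    have t1' := tendsto_biCosProduct_add hθ0 hb1 hb1
    have t2' := tendsto_biCosProduct_add hθ0 hb1 hb1.neg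
    have e : biCosProduct θ (-b) = biCosProduct θ b := by
      simp [biCosProduct]
    rw [e] at t2'
    obtain ⟨W, hW1, hW2, hW⟩ := ((t1'.eventually hev).and ((t2'.eventually hev).and
      (eventually_biCosProduct_ne_or_ne h1 hb0 hb1 hs))).exists
    rcases hW with hW | hW
    · refine hW1 ⟨hW, subset_closure ⟨1 + Polynomial.X ^ W, ?_⟩⟩
      simp [mul_add]
    · refine hW2 ⟨hW, subset_closure ⟨1 - Polynomial.X ^ W, ?_⟩⟩
      simp [sub_eq_add_neg, mul_add]
  have hne := hb1.biCosProduct_ne_zero hs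
  rw [← iteratedDerivedSet_closure]
  exact ⟨_, iteratedDerivedSet_mono _ hsub (pow_mem_iteratedDerivedSet hK hacc (mul_ne_zero hne hne) n)⟩

/-! ### Linear recurrences and hyperbolicity -/

/-- The shift `(ε k) ↦ (ε (k + 1))` on two-sided sequences. -/
def shiftEnd : Module.End ℂ (ℤ → ℂ) := LinearMap.funLeft ℂ ℂ fun k => k + 1

lemma shiftEnd_pow_apply (i : ℕ) (ε : ℤ → ℂ) (k : ℤ) : (shiftEnd ^ i) ε k = ε (k + i) := by
  induction i generalizing k with
  | zero => simp
  | succ i ih =>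
    rw [pow_succ', Module.End.mul_apply]
    change (shiftEnd ^ i) ε (k + 1) = _
    rw [ih]
    congr 1
    push_cast; ring

open Polynomial in
lemma aeval_shiftEnd_X_sub_C (a : ℂ) (ε : ℤ → ℂ) (k : ℤ) :
    (aeval shiftEnd (X - C a)) ε k = ε (k + 1) - a * ε k := by
  simp only [map_sub, aeval_X, aeval_C, LinearMap.sub_apply, Pi.sub_apply,
    Module.algebraMap_end_apply, Pi.smul_apply, smul_eq_mul]
  rfl

/-- The expression `∑ i, pᵢ ε (k + i)`. -/
noncomputable def recurrence (p : Polynomial ℤ) (ε : ℤ → ℝ) (k : ℤ) : ℝ :=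
  ∑ i ∈ Finset.range (p.natDegree + 1), p.coeff i * ε (k + i)

lemma ofReal_recurrence (p : Polynomial ℤ) (ε : ℤ → ℝ) (k : ℤ) :
    (recurrence p ε k : ℂ) =
      (Polynomial.aeval shiftEnd (p.map (algebraMap ℤ ℂ))) (fun j => (ε j : ℂ)) k := by
  rw [Polynomial.aeval_eq_sum_range, Polynomial.natDegree_map_eq_of_injective
    (algebraMap ℤ ℂ).injective_int, recurrence, LinearMap.sum_apply, Finset.sum_apply]
  push_cast
  refine Finset.sum_congr rfl fun i _ => ?_
  rw [LinearMap.smul_apply, Pi.smul_apply, shiftEnd_pow_apply]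
  simp

lemma recurrence_sub (p : Polynomial ℤ) (ε η : ℤ → ℝ) (k : ℤ) :
    recurrence p (ε - η) k = recurrence p ε k - recurrence p η k := by
  simp [recurrence, mul_sub]

lemma recurrence_mul_zpow (p : Polynomial ℤ) {θ : ℝ} (hθ : θ ≠ 0) (t : ℝ) (k : ℤ) :
    recurrence p (fun j => t * θ ^ j) k = t * θ ^ k * Polynomial.aeval θ p := by
  rw [recurrence, Polynomial.aeval_eq_sum_range, Finset.mul_sum]
  refine Finset.sum_congr rfl fun i _ => ?_
  rw [zpow_add₀ hθ, zpow_natCast, zsmul_eq_mul]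
  ring

lemma recurrence_comp_add (p : Polynomial ℤ) (ε : ℤ → ℝ) (m k : ℤ) :
    recurrence p (fun j => ε (m + j)) k = recurrence p ε (m + k) := by
  simp [recurrence, add_assoc]

lemma recurrence_congr (p : Polynomial ℤ) {ε η : ℤ → ℝ} {k : ℤ}
    (h : ∀ i : ℕ, i ≤ p.natDegree → ε (k + i) = η (k + i)) :
    recurrence p ε k = recurrence p η k :=
  Finset.sum_congr rfl fun i hi => by rw [h i (by simpa [Nat.lt_succ_iff] using hi)]

lemma abs_recurrence_le (p : Polynomial ℤ) {ε : ℤ → ℝ} {k : ℤ} {B : ℝ}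
    (h : ∀ i : ℕ, i ≤ p.natDegree → |ε (k + i)| ≤ B) :
    |recurrence p ε k| ≤ (∑ i ∈ Finset.range (p.natDegree + 1), |(p.coeff i : ℝ)|) * B := by
  rw [Finset.sum_mul]
  refine (Finset.abs_sum_le_sum_abs _ _).trans (Finset.sum_le_sum fun i hi => ?_)
  rw [abs_mul]
  gcongr
  exact h i (by simpa [Nat.lt_succ_iff] using hi)

lemma tendsto_recurrence (p : Polynomial ℤ) {ι : Type*} {l : Filter ι} {ε : ι → ℤ → ℝ} {η : ℤ → ℝ}
    {k : ℤ} (h : ∀ j, Tendsto (fun n => ε n j) l (𝓝 (η j))) :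
    Tendsto (fun n => recurrence p (ε n) k) l (𝓝 (recurrence p η k)) :=
  tendsto_finsetSum _ fun _ _ => (h _).const_mul _

lemma exists_int_eq_recurrence (p : Polynomial ℤ) (m : ℤ → ℤ) (k : ℤ) :
    ∃ n : ℤ, (n : ℝ) = recurrence p (fun j => m j) k :=
  ⟨∑ i ∈ Finset.range (p.natDegree + 1), p.coeff i * m (k + i), by simp [recurrence]⟩

/-- Weights varying by a factor of at most `ρ⁻¹` between neighbours. -/
structure IsModerate (ρ : ℝ) (w : ℤ → ℝ) : Prop where
  nonneg : ∀ k, 0 ≤ w k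
  le_succ : ∀ k, ρ * w k ≤ w (k + 1)
  succ_le : ∀ k, ρ * w (k + 1) ≤ w k

lemma IsModerate.anti {ρ ρ' : ℝ} {w : ℤ → ℝ} (h : IsModerate ρ' w) (hρ : ρ ≤ ρ') :
    IsModerate ρ w :=
  ⟨h.nonneg, fun k => (mul_le_mul_of_nonneg_right hρ (h.nonneg k)).trans (h.le_succ k),
    fun k => (mul_le_mul_of_nonneg_right hρ (h.nonneg _)).trans (h.succ_le k)⟩

lemma IsModerate.const_mul {ρ : ℝ} {w : ℤ → ℝ} (h : IsModerate ρ w) {c : ℝ} (hc : 0 ≤ c) :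
    IsModerate ρ fun k => c * w k :=
  ⟨fun k => mul_nonneg hc (h.nonneg k),
    fun k => by rw [mul_left_comm]; exact mul_le_mul_of_nonneg_left (h.le_succ k) hc,
    fun k => by rw [mul_left_comm]; exact mul_le_mul_of_nonneg_left (h.succ_le k) hc⟩

lemma le_of_forall_le_pow_mul_add {x l B y : ℝ} (hl0 : 0 ≤ l) (hl : l < 1)
    (h : ∀ m : ℕ, x ≤ l ^ m * B + y) : x ≤ y := by
  have : Tendsto (fun m : ℕ => l ^ m * B + y) atTop (𝓝 (0 * B + y)) :=
    ((tendsto_pow_atTop_nhds_zero_of_lt_one hl0 hl).mul_const B).add_const y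
  rw [zero_mul, zero_add] at this
  exact ge_of_tendsto' this h

/-- For `‖a‖ < 1` the difference equation is iterated from the past, for `‖a‖ > 1` from the future;
boundedness removes the homogeneous term. Taking `ρ` between `‖a‖` (or its inverse) and `1` makes
the weights vary slowly enough, and `D` is the fixed point of the resulting one-step estimate. -/
lemma exists_norm_le_of_norm_sub_mul_le {a : ℂ} (ha : ‖a‖ ≠ 1) :
    ∃ ρ D : ℝ, 0 < ρ ∧ ρ < 1 ∧ 0 ≤ D ∧ ∀ (ε : ℤ → ℂ) (w : ℤ → ℝ) (B : ℝ), IsModerate ρ w →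
      (∀ k, ‖ε k‖ ≤ B) → (∀ k, ‖ε (k + 1) - a * ε k‖ ≤ w k) → ∀ k, ‖ε k‖ ≤ D * w k := by
  rcases lt_or_gt_of_ne ha with ha | ha
  · obtain ⟨ρ, hρ, hρ1⟩ := exists_between ha
    have hρ0 : 0 < ρ := (norm_nonneg a).trans_lt hρ
    have hd : 0 < ρ - ‖a‖ := sub_pos.2 hρ
    refine ⟨ρ, 1 / (ρ - ‖a‖), hρ0, hρ1, by positivity, fun ε w B hw hB h k => ?_⟩
    refine le_of_forall_le_pow_mul_add (norm_nonneg a) ha (B := B) fun m => ?_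
    induction m generalizing k with
    | zero =>
      have := mul_nonneg (one_div_pos.2 hd).le (hw.nonneg k)
      linarith [hB k]
    | succ m ih =>
      obtain ⟨j, rfl⟩ : ∃ j, k = j + 1 := ⟨k - 1, by ring⟩
      have h1 : ‖ε (j + 1)‖ ≤ w j + ‖a‖ * ‖ε j‖ := by
        have := norm_add_le (ε (j + 1) - a * ε j) (a * ε j)
        rw [sub_add_cancel, norm_mul] at this
        linarith [h j]
      have h2 : ‖a‖ * ‖ε j‖ ≤ ‖a‖ * (‖a‖ ^ m * B + 1 / (ρ - ‖a‖) * w j) :=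
        mul_le_mul_of_nonneg_left (ih j) (norm_nonneg a)
      have h3 : w j + ‖a‖ * (1 / (ρ - ‖a‖) * w j) = 1 / (ρ - ‖a‖) * (ρ * w j) := by
        field_simp; ring
      have h4 : 1 / (ρ - ‖a‖) * (ρ * w j) ≤ 1 / (ρ - ‖a‖) * w (j + 1) :=
        mul_le_mul_of_nonneg_left (hw.le_succ j) (one_div_pos.2 hd).le
      rw [pow_succ']
      linarith
  · obtain ⟨ρ, hρ, hρ1⟩ := exists_between (inv_lt_one_of_one_lt₀ ha)
    have ha0 : 0 < ‖a‖ := one_pos.trans ha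
    have hρ0 : 0 < ρ := (inv_pos.2 ha0).trans hρ
    have hd : 0 < ρ * ‖a‖ - 1 := by
      rw [inv_lt_iff_one_lt_mul₀ ha0] at hρ; linarith
    refine ⟨ρ, ρ / (ρ * ‖a‖ - 1), hρ0, hρ1, by positivity, fun ε w B hw hB h k => ?_⟩
    refine le_of_forall_le_pow_mul_add (inv_nonneg.2 ha0.le) (inv_lt_one_of_one_lt₀ ha) (B := B)
      fun m => ?_
    induction m generalizing k with
    | zero =>
      have := mul_nonneg (div_pos hρ0 hd).le (hw.nonneg k)
      linarith [hB k]
    | succ m ih =>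
      have h1 : ‖a‖ * ‖ε k‖ ≤ ‖ε (k + 1)‖ + w k := by
        have := norm_sub_le (ε (k + 1)) (ε (k + 1) - a * ε k)
        rw [sub_sub_cancel, norm_mul] at this
        linarith [h k]
      have h2 := ih (k + 1)
      have h3 : w k + ρ / (ρ * ‖a‖ - 1) * w (k + 1) ≤ ‖a‖ * (ρ / (ρ * ‖a‖ - 1) * w k) := by
        have e : ‖a‖ * (ρ / (ρ * ‖a‖ - 1) * w k) = w k + 1 / (ρ * ‖a‖ - 1) * w k := by
          have hx : ρ * ‖a‖ = (ρ * ‖a‖ - 1) + 1 := by ring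
          calc ‖a‖ * (ρ / (ρ * ‖a‖ - 1) * w k)
              = (ρ * ‖a‖) * (1 / (ρ * ‖a‖ - 1)) * w k := by ring
            _ = ((ρ * ‖a‖ - 1) * (1 / (ρ * ‖a‖ - 1))) * w k
                  + 1 / (ρ * ‖a‖ - 1) * w k := by nth_rw 1 [hx]; ring
            _ = _ := by rw [mul_one_div_cancel hd.ne', one_mul]
        have e2 : ρ / (ρ * ‖a‖ - 1) * w (k + 1) = 1 / (ρ * ‖a‖ - 1) * (ρ * w (k + 1)) := by
          ring
        rw [e, e2]
        have := mul_le_mul_of_nonneg_left (hw.succ_le k) (one_div_pos.2 hd).le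
        linarith
      have h4 : ‖a‖ * ((‖a‖⁻¹) ^ (m + 1) * B) = (‖a‖⁻¹) ^ m * B := by
        rw [pow_succ', ← mul_assoc, ← mul_assoc, mul_inv_cancel₀ ha0.ne', one_mul]
      refine le_of_mul_le_mul_left ?_ ha0
      rw [mul_add, h4]
      linarith

open Polynomial in
/-- Bounded sequences are controlled by their images under a hyperbolic difference operator. -/
lemma exists_norm_le_of_norm_aeval_shiftEnd_le (s : Multiset ℂ) (hs : ∀ a ∈ s, ‖a‖ ≠ 1) :
    ∃ ρ D : ℝ, 0 < ρ ∧ ρ < 1 ∧ 0 ≤ D ∧ ∀ (ε : ℤ → ℂ) (w : ℤ → ℝ) (B : ℝ), IsModerate ρ w →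
      (∀ k, ‖ε k‖ ≤ B) → (∀ k, ‖aeval shiftEnd (s.map fun a => X - C a).prod ε k‖ ≤ w k) →
      ∀ k, ‖ε k‖ ≤ D * w k := by
  induction s using Multiset.induction_on with
  | empty =>
    refine ⟨1 / 2, 1, by norm_num, by norm_num, by norm_num, fun ε w B _ _ h k => ?_⟩
    simpa using h k
  | cons a s ih =>
    obtain ⟨ρ₁, D₁, h1, h1', hD1, H1⟩ := ih fun b hb => hs b (Multiset.mem_cons_of_mem hb)
    obtain ⟨ρ₂, D₂, h2, h2', hD2, H2⟩ :=
      exists_norm_le_of_norm_sub_mul_le (hs a (Multiset.mem_cons_self a s))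
    refine ⟨max ρ₁ ρ₂, D₂ * D₁, lt_max_of_lt_left h1, max_lt h1' h2', by positivity,
      fun ε w B hw hB h k => ?_⟩
    rw [mul_assoc]
    refine H2 ε (fun k => D₁ * w k) B ((hw.anti (le_max_right _ _)).const_mul hD1) hB
      (fun k => ?_) k
    have := H1 (aeval shiftEnd (X - C a) ε) w (B + ‖a‖ * B) (hw.anti (le_max_left _ _))
      (fun k => ?_) (fun k => ?_) k
    · rwa [aeval_shiftEnd_X_sub_C] at this
    · rw [aeval_shiftEnd_X_sub_C]
      refine (norm_sub_le _ _).trans (add_le_add (hB _) ?_)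
      rw [norm_mul]
      exact mul_le_mul_of_nonneg_left (hB k) (norm_nonneg a)
    · have := h k
      rwa [Multiset.map_cons, Multiset.prod_cons, mul_comm, map_mul, Module.End.mul_apply] at this

open Polynomial in
/-- A sequence bounded on a negative half-line and annihilated there by a contracting difference
operator vanishes. -/
lemma eq_zero_of_aeval_shiftEnd_eq_zero (s : Multiset ℂ) (hs : ∀ a ∈ s, ‖a‖ < 1) {η : ℤ → ℂ}
    {B : ℝ} {N : ℤ} (hB : ∀ k ≤ N, ‖η k‖ ≤ B)
    (h : ∀ k, k + s.card ≤ N → aeval shiftEnd (s.map fun a => X - C a).prod η k = 0) :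
    ∀ k ≤ N, η k = 0 := by
  induction s using Multiset.induction_on generalizing η B N with
  | empty => simpa using h
  | cons a s ih =>
    have ha := hs a (Multiset.mem_cons_self a s)
    have hζ : ∀ k ≤ N - 1, aeval shiftEnd (X - C a) η k = 0 := by
      refine ih (fun b hb => hs b (Multiset.mem_cons_of_mem hb)) (B := B + ‖a‖ * B)
        (fun k hk => ?_) fun k hk => ?_
      · rw [aeval_shiftEnd_X_sub_C]
        refine (norm_sub_le _ _).trans (add_le_add (hB _ (by lia)) ?_)
        rw [norm_mul]
        exact mul_le_mul_of_nonneg_left (hB k (by lia)) (norm_nonneg a)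
      · have := h k (by rw [Multiset.card_cons]; push_cast; lia)
        rwa [Multiset.map_cons, Multiset.prod_cons, mul_comm, map_mul,
          Module.End.mul_apply] at this
    intro k hk
    have hle : ‖η k‖ ≤ 0 := by
      -- Going back `m` steps gives `η k = a ^ m * η (k - m)`, with `η` bounded in the past.
      refine le_of_forall_le_pow_mul_add (norm_nonneg a) ha (B := B) fun m => ?_
      rw [add_zero]
      induction m generalizing k with
      | zero => simpa using hB k hk
      | succ m ihm =>
        have h1 := hζ (k - 1) (by lia)
        rw [aeval_shiftEnd_X_sub_C, sub_add_cancel, sub_eq_zero] at h1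
        rw [h1, norm_mul, pow_succ', mul_assoc]
        exact mul_le_mul_of_nonneg_left (ihm (k - 1) (by lia)) (norm_nonneg a)
    exact norm_le_zero_iff.1 hle

lemma minpoly_map_algebraMap_complex {θ : ℝ} (hθ : IsIntegral ℤ θ) :
    (minpoly ℤ θ).map (algebraMap ℤ ℂ) = (minpoly ℚ θ).map (algebraMap ℚ ℂ) := by
  rw [minpoly.isIntegrallyClosed_eq_field_fractions' ℚ hθ, Polynomial.map_map,
    ← IsScalarTower.algebraMap_eq]

lemma minpoly_map_eq_prod {θ : ℝ} (hθ : IsIntegral ℤ θ) :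
    (minpoly ℤ θ).map (algebraMap ℤ ℂ) = (((minpoly ℤ θ).map (algebraMap ℤ ℂ)).roots.map
      fun a => Polynomial.X - Polynomial.C a).prod :=
  (IsAlgClosed.splits _).eq_prod_roots_of_monic ((minpoly.monic hθ).map _)

lemma IsPisot.eq_or_norm_lt_one {θ : ℝ} (hθ : IsPisot θ) {z : ℂ}
    (hz : z ∈ ((minpoly ℤ θ).map (algebraMap ℤ ℂ)).roots) : z = θ ∨ ‖z‖ < 1 := by
  refine or_iff_not_imp_left.2 (hθ.2.2 z ?_)
  have := Polynomial.isRoot_of_mem_roots hz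
  rwa [minpoly_map_algebraMap_complex hθ.1, Polynomial.IsRoot, Polynomial.eval_map_algebraMap]
    at this

lemma IsPisot.exists_abs_le_of_abs_recurrence_le {θ : ℝ} (hθ : IsPisot θ) :
    ∃ ρ D : ℝ, 0 < ρ ∧ ρ < 1 ∧ 0 ≤ D ∧ ∀ (ε : ℤ → ℝ) (w : ℤ → ℝ) (B : ℝ), IsModerate ρ w →
      (∀ k, |ε k| ≤ B) → (∀ k, |recurrence (minpoly ℤ θ) ε k| ≤ w k) →
      ∀ k, |ε k| ≤ D * w k := by
  obtain ⟨ρ, D, h0, h1, hD, H⟩ := exists_norm_le_of_norm_aeval_shiftEnd_le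
    ((minpoly ℤ θ).map (algebraMap ℤ ℂ)).roots fun z hz => by
      rcases hθ.eq_or_norm_lt_one hz with rfl | h
      · rw [Complex.norm_real, Real.norm_of_nonneg (by linarith [hθ.2.1])]
        exact hθ.2.1.ne'
      · exact h.ne
  refine ⟨ρ, D, h0, h1, hD, fun ε w B hw hB h k => ?_⟩
  have := H (fun j => (ε j : ℂ)) w B hw (fun k => by simpa using hB k) (fun k => by
    rw [← minpoly_map_eq_prod hθ.1, ← ofReal_recurrence, Complex.norm_real]
    exact h k) k
  simpa using this

/-- A contracting mode blows up towards `-∞`, so boundedness there leaves only the mode `θ ^ k`.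
Concretely, the other roots annihilate `η (k + 1) - θ * η k`; separability ensures that `θ` is not
among them. -/
lemma IsPisot.eq_mul_zpow_of_recurrence_eq_zero {θ : ℝ} (hθ : IsPisot θ) {η : ℤ → ℝ} {B : ℝ}
    (hB : ∀ k ≤ 0, |η k| ≤ B)
    (h : ∀ k : ℤ, k + (minpoly ℤ θ).natDegree ≤ 0 → recurrence (minpoly ℤ θ) η k = 0) :
    ∀ k ≤ 0, η k = η 0 * θ ^ k := by
  have h0 : θ ≠ 0 := by linarith [hθ.2.1]
  set R := ((minpoly ℤ θ).map (algebraMap ℤ ℂ)).roots with hR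
  have hmem : (θ : ℂ) ∈ R := by
    rw [hR, Polynomial.mem_roots ((minpoly.monic hθ.1).map _).ne_zero,
      minpoly_map_algebraMap_complex hθ.1, Polynomial.IsRoot, Polynomial.eval_map_algebraMap]
    have := Polynomial.aeval_algebraMap_apply ℂ θ (minpoly ℚ θ)
    rw [minpoly.aeval, map_zero] at this
    exact this
  have hnd : R.Nodup := by
    rw [hR, minpoly_map_algebraMap_complex hθ.1]
    exact Polynomial.nodup_roots
      ((minpoly.irreducible (hθ.1.tower_top (A := ℚ))).separable.map)
  obtain ⟨s, hs⟩ := Multiset.exists_cons_of_mem hmem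
  have hs1 : ∀ a ∈ s, ‖a‖ < 1 := fun a ha => by
    refine (hθ.eq_or_norm_lt_one (z := a) ?_).resolve_left ?_
    · rw [← hR, hs]; exact Multiset.mem_cons_of_mem ha
    · rintro rfl
      rw [hs] at hnd
      exact (Multiset.nodup_cons.1 hnd).1 ha
  have hcard : (minpoly ℤ θ).natDegree = s.card + 1 := by
    rw [← (minpoly.monic hθ.1).natDegree_map (algebraMap ℤ ℂ),
      (IsAlgClosed.splits _).natDegree_eq_card_roots, ← hR, hs, Multiset.card_cons]
  have hprod := minpoly_map_eq_prod hθ.1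
  rw [← hR, hs, Multiset.map_cons, Multiset.prod_cons, mul_comm] at hprod
  have hB' (k : ℤ) (hk : k ≤ 0) : ‖(η k : ℂ)‖ ≤ B := by simpa using hB k hk
  have hζ := eq_zero_of_aeval_shiftEnd_eq_zero s hs1 (N := -1) (B := B + ‖(θ : ℂ)‖ * B)
    (η := Polynomial.aeval shiftEnd (Polynomial.X - Polynomial.C (θ : ℂ)) fun j => (η j : ℂ))
    (fun k hk => by
      rw [aeval_shiftEnd_X_sub_C]
      refine (norm_sub_le _ _).trans (add_le_add (hB' _ (by lia)) ?_)
      rw [norm_mul]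
      exact mul_le_mul_of_nonneg_left (hB' k (by lia)) (norm_nonneg _))
    (fun k hk => by
      have := h k (by rw [hcard]; push_cast; lia)
      rw [← Module.End.mul_apply, ← map_mul, ← hprod, ← ofReal_recurrence, this]
      simp)
  have hstep (k : ℤ) (hk : k ≤ -1) : η (k + 1) = θ * η k := by
    have := hζ k hk
    rw [aeval_shiftEnd_X_sub_C, sub_eq_zero] at this
    exact_mod_cast this
  have hnat (n : ℕ) : η (-n) = η 0 * θ ^ (-(n : ℤ)) := by
    induction n with
    | zero => simp
    | succ n ih =>
      have h1 := hstep (-(n + 1 : ℕ)) (by push_cast; lia)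
      have e : (-((n + 1 : ℕ) : ℤ) + 1) = -n := by push_cast; ring
      rw [e, ih] at h1
      have e2 : θ ^ (-(n : ℤ)) = θ * θ ^ (-((n + 1 : ℕ) : ℤ)) := by
        rw [← e, zpow_add₀ h0, zpow_one, mul_comm]
      rw [e2] at h1
      have h2 : θ * (η 0 * θ ^ (-((n + 1 : ℕ) : ℤ))) = θ * η (-((n + 1 : ℕ) : ℤ)) := by
        rw [← h1]; ring
      exact (mul_left_cancel₀ h0 h2).symm
  intro k hk
  obtain ⟨n, rfl⟩ : ∃ n : ℕ, k = -n := ⟨(-k).toNat, by lia⟩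
  exact hnat n

/-! ### Countable families of bounded sequences -/

/-- Bounded two-sided sequences satisfying the recurrence of `θ` up to finitely many integer
errors. -/
def homoclinicSequences (θ : ℝ) : Set (ℤ → ℝ) :=
  {ε | (∀ k, |ε k| ≤ 1 / 2) ∧ ∃ σ : ℤ →₀ ℤ, ∀ k, recurrence (minpoly ℤ θ) ε k = σ k}

/-- The finitely supported `σ` determines `ε`: a difference of two solutions is bounded and
homogeneous, hence zero by the hyperbolic estimate with weight `0`. -/
lemma IsPisot.countable_homoclinicSequences {θ : ℝ} (hθ : IsPisot θ) :
    (homoclinicSequences θ).Countable := by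
  have hsub : homoclinicSequences θ ⊆ ⋃ σ : ℤ →₀ ℤ,
      {ε | (∀ k, |ε k| ≤ 1 / 2) ∧ ∀ k, recurrence (minpoly ℤ θ) ε k = σ k} := by
    rintro ε ⟨h1, σ, h2⟩
    exact Set.mem_iUnion.2 ⟨σ, h1, h2⟩
  refine (Set.countable_iUnion fun σ => Set.Subsingleton.countable ?_).mono hsub
  rintro ε ⟨h1, h2⟩ η ⟨h3, h4⟩
  obtain ⟨ρ, D, -, -, -, H⟩ := hθ.exists_abs_le_of_abs_recurrence_le
  have := H (ε - η) (fun _ => 0) (1 / 2 + 1 / 2)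
    ⟨fun _ => le_rfl, fun _ => by simp, fun _ => by simp⟩
    (fun k => (abs_sub _ _).trans (add_le_add (h1 k) (h3 k)))
    (fun k => by rw [recurrence_sub, h2, h4]; simp)
  ext k
  have h5 := this k
  rw [mul_zero, Pi.sub_apply] at h5
  exact sub_eq_zero.1 (abs_nonpos_iff.1 h5)

/-- Bounded sequences supported on the nonpositive integers, satisfying there the recurrence of `θ`
up to finitely many integer errors, as well as an integrality condition at the boundary. -/
def boundarySequences (θ : ℝ) (c : Polynomial ℤ) : Set (ℤ → ℝ) :=
  {ε | (∀ k, |ε k| ≤ 1 / 2) ∧ (∀ k > 0, ε k = 0) ∧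
    (∃ σ : ℤ →₀ ℤ, ∀ k : ℤ, k + (minpoly ℤ θ).natDegree ≤ 0 →
      recurrence (minpoly ℤ θ) ε k = σ k) ∧
    ∃ j : ℤ, recurrence c ε (-(minpoly ℤ θ).natDegree) = j}

/-- With `σ` fixed, two solutions differ on the half-line by a multiple of `θ ^ k`. Equal values of
`j` make that multiple zero, since applying `c` multiplies it by a nonzero power of `θ` times `c(θ)
≠ 0`. -/
lemma IsPisot.countable_boundarySequences {θ : ℝ} (hθ : IsPisot θ) {c : Polynomial ℤ}
    (hc : c.natDegree < (minpoly ℤ θ).natDegree) (hc0 : Polynomial.aeval θ c ≠ 0) :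
    (boundarySequences θ c).Countable := by
  have hsub : boundarySequences θ c ⊆ ⋃ (σ : ℤ →₀ ℤ) (j : ℤ),
      {ε | (∀ k, |ε k| ≤ 1 / 2) ∧ (∀ k > 0, ε k = 0) ∧
        (∀ k : ℤ, k + (minpoly ℤ θ).natDegree ≤ 0 → recurrence (minpoly ℤ θ) ε k = σ k) ∧
        recurrence c ε (-(minpoly ℤ θ).natDegree) = j} := by
    rintro ε ⟨h1, h2, ⟨σ, h3⟩, j, h4⟩
    exact Set.mem_iUnion₂.2 ⟨σ, j, h1, h2, h3, h4⟩
  refine (Set.countable_iUnion fun σ => Set.countable_iUnion fun j =>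
    Set.Subsingleton.countable ?_).mono hsub
  rintro ε ⟨h1, h2, h3, h4⟩ η ⟨g1, g2, g3, g4⟩
  have h0 : θ ≠ 0 := by linarith [hθ.2.1]
  have key := hθ.eq_mul_zpow_of_recurrence_eq_zero (η := ε - η) (B := 1 / 2 + 1 / 2)
    (fun k _ => (abs_sub _ _).trans (add_le_add (h1 k) (g1 k)))
    (fun k hk => by rw [recurrence_sub, h3 k hk, g3 k hk, sub_self])
  have hz : (ε - η) 0 = 0 := by
    have e1 : recurrence c (ε - η) (-(minpoly ℤ θ).natDegree) = 0 := by
      rw [recurrence_sub, h4, g4, sub_self]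
    rw [recurrence_congr c (η := fun k => (ε - η) 0 * θ ^ k) fun i hi => key _ (by lia),
      recurrence_mul_zpow c h0] at e1
    rcases mul_eq_zero.1 e1 with e1 | e1
    · exact (mul_eq_zero.1 e1).resolve_right (zpow_ne_zero _ h0)
    · exact absurd e1 hc0
  ext k
  rcases le_or_gt k 0 with hk | hk
  · have := key k hk
    rw [hz, zero_mul, Pi.sub_apply] at this
    exact sub_eq_zero.1 this
  · rw [h2 k hk, g2 k hk]

/-! ### Clusters of positions along an ultrafilter -/

lemma Ultrafilter.eventually_eq_or_forall_lt_abs {ι : Type*} (U : Ultrafilter ι) (f : ι → ℤ) :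
    (∃ m, ∀ᶠ n in U, f n = m) ∨ ∀ L : ℤ, ∀ᶠ n in U, L < |f n| := by
  refine or_iff_not_imp_right.2 fun h => ?_
  push Not at h
  obtain ⟨L, hL⟩ := h
  have h2 : (⋃ m ∈ Set.Icc (-L) L, {n | f n = m}) ∈ U := by
    refine mem_of_superset hL fun n hn => ?_
    simp only [Set.mem_iUnion, Set.mem_ofPred_eq, exists_prop, exists_eq_right', Set.mem_Icc]
    exact abs_le.1 hn
  rw [Ultrafilter.finite_biUnion_mem_iff (Set.finite_Icc _ _)] at h2
  obtain ⟨m, -, hm⟩ := h2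
  exact ⟨m, hm⟩

lemma Ultrafilter.exists_tendsto_of_abs_le {ι : Type*} (U : Ultrafilter ι) {f : ι → ℝ} {B : ℝ}
    (hf : ∀ n, |f n| ≤ B) : ∃ x, Tendsto f U (𝓝 x) := by
  obtain ⟨x, -, hx⟩ := (isCompact_Icc (a := -B) (b := B)).ultrafilter_le_nhds (U.map f) (by
    rw [Ultrafilter.coe_map, le_principal_iff]
    exact mem_map.2 (Eventually.of_forall fun n => abs_le.1 (hf n)))
  exact ⟨x, hx⟩

/-- A finite family of integer positions splits, along an ultrafilter, into clusters at bounded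
distance from representatives diverging from each other. -/
lemma Ultrafilter.exists_representatives {ι : Type*} (U : Ultrafilter ι) {M : ℕ}
    (p : ι → Fin M → ℤ) : ∃ (R : Finset (Fin M)) (L : ℕ),
      (∀ᶠ n in U, ∀ i, ∃ c ∈ R, |p n i - p n c| ≤ L) ∧
      ∀ W : ℤ, ∀ᶠ n in U, ∀ c ∈ R, ∀ c' ∈ R, c ≠ c' → W < |p n c - p n c'| := by
  classical
  -- Two indices are equivalent when their positions differ by a constant along `U`; inequivalent
  -- ones diverge from each other.
  let S : Setoid (Fin M) :=
    { r := fun i j => ∃ m, ∀ᶠ n in U, p n i - p n j = m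
      iseqv :=
        { refl := fun i => ⟨0, by simp⟩
          symm := fun ⟨m, hm⟩ => ⟨-m, hm.mono fun n h => by rw [← h]; ring⟩
          trans := fun ⟨m, hm⟩ ⟨m', hm'⟩ => ⟨m + m', (hm.and hm').mono fun n h => by
            rw [← h.1, ← h.2]; ring⟩ } }
  have hout (i : Fin M) : ∃ m, ∀ᶠ n in U, p n i - p n (Quotient.mk S i).out = m :=
    S.symm (Quotient.mk_out i)
  choose m hm using hout
  refine ⟨Finset.univ.image fun i => (Quotient.mk S i).out, ∑ i, (m i).natAbs, ?_, fun W => ?_⟩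
  · filter_upwards [eventually_all.2 hm] with n hn i
    refine ⟨_, Finset.mem_image_of_mem _ (Finset.mem_univ i), ?_⟩
    rw [hn i, Int.abs_eq_natAbs]
    exact_mod_cast Finset.single_le_sum (f := fun i => (m i).natAbs) (fun _ _ => Nat.zero_le _)
      (Finset.mem_univ i)
  · simp only [Finset.eventually_all]
    intro c hc c' hc'
    obtain ⟨i, -, rfl⟩ := Finset.mem_image.1 hc
    obtain ⟨j, -, rfl⟩ := Finset.mem_image.1 hc'
    rcases U.eventually_eq_or_forall_lt_abs
      (fun n => p n (Quotient.mk S i).out - p n (Quotient.mk S j).out) with h | h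
    · refine Eventually.of_forall fun n hne => absurd ?_ hne
      have h2 : Quotient.mk S (Quotient.mk S i).out = Quotient.mk S (Quotient.mk S j).out :=
        Quotient.sound h
      rw [Quotient.out_eq, Quotient.out_eq] at h2
      rw [h2]
    · exact (h W).mono fun n hn _ => hn

lemma abs_prod_sub_prod_le_sum_sdiff {ι : Type*} [DecidableEq ι] {S T : Finset ι} (hTS : T ⊆ S)
    {a : ι → ℝ} (ha : ∀ i, |a i| ≤ 1) :
    |∏ i ∈ S, a i - ∏ i ∈ T, a i| ≤ ∑ i ∈ S \ T, |a i - 1| := by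
  have h := abs_prod_sub_prod_le S (a := a) (b := fun i => if i ∈ T then a i else 1) ha
    fun i => by split_ifs <;> simp [ha i]
  have h2 : ∏ i ∈ S, (if i ∈ T then a i else 1) = ∏ i ∈ T, a i := by
    rw [Finset.prod_ite_mem, Finset.inter_eq_right.2 hTS]
  rw [h2] at h
  refine h.trans_eq ?_
  rw [← Finset.sum_sdiff hTS, add_eq_left.2]
  · exact Finset.sum_congr rfl fun i hi => by rw [if_neg (Finset.mem_sdiff.1 hi).2]
  · exact Finset.sum_eq_zero fun i hi => by simp [hi]

lemma summable_pow_natAbs {q : ℝ} (hq0 : 0 ≤ q) (hq1 : q < 1) :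
    Summable fun k : ℤ => q ^ k.natAbs := by
  refine Summable.of_nat_of_neg ?_ ?_ <;> simpa using summable_geometric_of_lt_one hq0 hq1

lemma abs_abs_cos_sub_one_le (x : ℝ) : |(|Real.cos x| - 1)| ≤ |x| := by
  have h := Real.abs_cos_sub_cos_le x 0
  rw [Real.cos_zero, sub_zero] at h
  have := abs_abs_sub_abs_le (Real.cos x) 1
  rw [abs_one] at this
  exact this.trans h

/-- Away from the `W`-neighbourhoods of the cluster representatives the product is close to `1`. -/
lemma abs_prod_sub_prod_windows_le {M : ℕ} {p : Fin M → ℤ} {ε : ℤ → ℝ} {A q : ℝ} (hA : 0 ≤ A)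
    (hq0 : 0 < q) (hq1 : q < 1)
    (hε : ∀ k, |ε k| ≤ A * ∑ i, (q * q) ^ (k - p i).natAbs) {R : Finset (Fin M)} {L W : ℕ}
    (hL : ∀ i, ∃ c ∈ R, |p i - p c| ≤ L)
    (hW : ∀ c ∈ R, ∀ c' ∈ R, c ≠ c' → 2 * (W : ℤ) < |p c - p c'|) {y : ℝ}
    (hy : Tendsto (fun K : ℕ => ∏ k ∈ Finset.Icc (-(K : ℤ)) K, |Real.cos (Real.pi * ε k)|) atTop
      (𝓝 y)) :
    ‖y - ∏ c ∈ R, ∏ k ∈ Finset.Icc (-(W : ℤ)) W, |Real.cos (Real.pi * ε (p c + k))|‖ ≤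
      Real.pi * A * M * (∑' k : ℤ, q ^ k.natAbs) * q ^ (W - L) := by
  classical
  let V : Fin M → Finset ℤ := fun c => (Finset.Icc (-(W : ℤ)) W).map (addLeftEmbedding (p c))
  have hV (c : Fin M) (k : ℤ) : k ∈ V c ↔ |k - p c| ≤ W := by
    simp only [V, Finset.mem_map, Finset.mem_Icc, addLeftEmbedding_apply, abs_le]
    exact ⟨fun ⟨a, h, e⟩ => by lia, fun h => ⟨k - p c, by lia, by lia⟩⟩
  have hdisj : (R : Set (Fin M)).PairwiseDisjoint V := by
    intro c hc c' hc' hne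
    rw [Function.onFun, Finset.disjoint_left]
    intro k hk hk'
    rw [hV] at hk hk'
    have := hW c hc c' hc' hne
    have h3 := abs_sub_le (p c) k (p c')
    rw [abs_sub_comm] at hk
    lia
  set T := R.biUnion V with hT
  have hprod : ∏ c ∈ R, ∏ k ∈ Finset.Icc (-(W : ℤ)) W, |Real.cos (Real.pi * ε (p c + k))| =
      ∏ k ∈ T, |Real.cos (Real.pi * ε k)| := by
    rw [hT, Finset.prod_biUnion hdisj]
    refine Finset.prod_congr rfl fun c _ => ?_
    rw [Finset.prod_map]
    rfl
  rw [hprod]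
  have hlim := (hy.sub_const (∏ k ∈ T, |Real.cos (Real.pi * ε k)|)).norm
  refine le_of_tendsto hlim ?_
  obtain ⟨K₀, hK₀⟩ := (T.image Int.natAbs).bddAbove
  filter_upwards [eventually_ge_atTop K₀] with K hK
  have hTS : T ⊆ Finset.Icc (-(K : ℤ)) K := fun k hk => by
    have : k.natAbs ≤ K₀ := hK₀ (by
      rw [Finset.coe_image]; exact ⟨k, hk, rfl⟩)
    rw [Finset.mem_Icc]; lia
  refine (abs_prod_sub_prod_le_sum_sdiff hTS fun k => ?_).trans ?_
  · rw [abs_abs]; exact Real.abs_cos_le_one _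
  set D := Finset.Icc (-(K : ℤ)) K \ T
  -- Outside the windows `|k - p i| ≥ W - L`. One of the two factors `q` supplies the smallness, the
  -- other is kept for summability.
  have hterm (i : Fin M) (k : ℤ) (hk : k ∈ D) :
      (q * q) ^ (k - p i).natAbs ≤ q ^ (W - L) * q ^ (k - p i).natAbs := by
    obtain ⟨c, hc, hic⟩ := hL i
    have hkc : ¬ |k - p c| ≤ W := fun h =>
      (Finset.mem_sdiff.1 hk).2 (Finset.mem_biUnion.2 ⟨c, hc, (hV c k).2 h⟩)
    have hle : W - L ≤ (k - p i).natAbs := by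
      have := abs_sub_le k (p i) (p c)
      rw [Int.abs_eq_natAbs (k - p i)] at this
      lia
    rw [mul_pow]
    exact mul_le_mul_of_nonneg_right (pow_le_pow_of_le_one hq0.le hq1.le hle) (by positivity)
  have hsum (i : Fin M) : ∑ k ∈ D, q ^ (k - p i).natAbs ≤ ∑' k : ℤ, q ^ k.natAbs := by
    have := (summable_pow_natAbs hq0.le hq1).sum_le_tsum (D.map (addRightEmbedding (-p i)))
      fun k _ => by positivity
    simpa [Finset.sum_map, ← sub_eq_add_neg] using this
  calc ∑ k ∈ D, |(|Real.cos (Real.pi * ε k)| - 1)|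
      ≤ ∑ k ∈ D, Real.pi * (A * ∑ i, q ^ (W - L) * q ^ (k - p i).natAbs) := by
        refine Finset.sum_le_sum fun k hk => (abs_abs_cos_sub_one_le _).trans ?_
        rw [abs_mul, abs_of_pos Real.pi_pos]
        refine mul_le_mul_of_nonneg_left ((hε k).trans ?_) Real.pi_pos.le
        exact mul_le_mul_of_nonneg_left (Finset.sum_le_sum fun i _ => hterm i k hk) hA
    _ = Real.pi * A * q ^ (W - L) * ∑ i, ∑ k ∈ D, q ^ (k - p i).natAbs := by
        rw [Finset.sum_comm, Finset.mul_sum]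
        refine Finset.sum_congr rfl fun k _ => ?_
        simp only [Finset.mul_sum]
        exact Finset.sum_congr rfl fun i _ => by ring
    _ ≤ Real.pi * A * q ^ (W - L) * ∑ _i : Fin M, ∑' k : ℤ, q ^ k.natAbs := by
        have := Real.pi_pos
        gcongr with i
        exact hsum i
    _ = _ := by
        rw [Finset.sum_const, Finset.card_univ, Fintype.card_fin, nsmul_eq_mul]; ring

/-- Along an ultrafilter, products of cosines which are close to `1` away from boundedly many
positions converge to a product over the clusters of positions. -/
lemma Ultrafilter.exists_tendsto_prod_windows {ι : Type*} (U : Ultrafilter ι) {M : ℕ}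
    (p : ι → Fin M → ℤ) (ε : ι → ℤ → ℝ) {A q : ℝ} (hA : 0 ≤ A) (hq0 : 0 < q) (hq1 : q < 1)
    (hε : ∀ᶠ n in U, ∀ k, |ε n k| ≤ A * ∑ i, (q * q) ^ (k - p n i).natAbs) (y : ι → ℝ)
    (hy : ∀ n, Tendsto (fun K : ℕ => ∏ k ∈ Finset.Icc (-(K : ℤ)) K, |Real.cos (Real.pi * ε n k)|)
      atTop (𝓝 (y n)))
    {z : ℝ} (hz : Tendsto y U (𝓝 z)) {e : Fin M → ℤ → ℝ}
    (he : ∀ i k, Tendsto (fun n => ε n (p n i + k)) U (𝓝 (e i k))) :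
    ∃ R : Finset (Fin M), Tendsto (fun W : ℕ => ∏ c ∈ R, ∏ k ∈ Finset.Icc (-(W : ℤ)) W,
      |Real.cos (Real.pi * e c k)|) atTop (𝓝 z) := by
  obtain ⟨R, L, hL, hR⟩ := U.exists_representatives p
  refine ⟨R, ?_⟩
  have hbound (W : ℕ) : ‖z - ∏ c ∈ R, ∏ k ∈ Finset.Icc (-(W : ℤ)) W,
      |Real.cos (Real.pi * e c k)|‖ ≤
      Real.pi * A * M * (∑' k : ℤ, q ^ k.natAbs) * q ^ (W - L) := by
    have hlim : Tendsto (fun n => ∏ c ∈ R, ∏ k ∈ Finset.Icc (-(W : ℤ)) W,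
        |Real.cos (Real.pi * ε n (p n c + k))|) U (𝓝 (∏ c ∈ R, ∏ k ∈ Finset.Icc (-(W : ℤ)) W,
        |Real.cos (Real.pi * e c k)|)) :=
      tendsto_finsetProd _ fun c _ => tendsto_finsetProd _ fun k _ =>
        ((Real.continuous_cos.tendsto _).comp ((he c k).const_mul Real.pi)).abs
    refine le_of_tendsto (hz.sub hlim).norm ?_
    filter_upwards [hε, hL, hR (2 * W)] with n h1 h2 h3
    exact abs_prod_sub_prod_windows_le hA hq0 hq1 h1 h2 h3 (hy n)
  rw [tendsto_iff_dist_tendsto_zero]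
  refine squeeze_zero (fun _ => dist_nonneg) (fun W => ?_) ?_
    (g := fun W : ℕ => Real.pi * A * M * (∑' k : ℤ, q ^ k.natAbs) * q ^ (W - L))
  · rw [dist_comm, dist_eq_norm]; exact hbound W
  · have := ((tendsto_pow_atTop_nhds_zero_of_lt_one hq0.le hq1).comp
      (tendsto_sub_atTop_nat L)).const_mul (Real.pi * A * M * (∑' k : ℤ, q ^ k.natAbs))
    simpa [Function.comp_def] using this

/-! ### Rounding errors -/

/-- The signed distances of `t θ^k`, `k ≤ 0`, to the nearest integers. -/
noncomputable def roundingError (θ t : ℝ) (k : ℤ) : ℝ :=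
  if k ≤ 0 then t * θ ^ k - round (t * θ ^ k) else 0

lemma abs_roundingError_le (θ t : ℝ) (k : ℤ) : |roundingError θ t k| ≤ 1 / 2 := by
  rw [roundingError]
  split_ifs
  · exact abs_sub_round _
  · norm_num

lemma roundingError_of_pos (θ t : ℝ) {k : ℤ} (hk : 0 < k) : roundingError θ t k = 0 :=
  if_neg (not_le.2 hk)

/-- The recurrence multiplies `t θ^k` by `p(θ)` and sends the rounded values to an integer. The
condition on `k` keeps all indices on the side of the cut where rounding errors are genuine. -/
lemma recurrence_roundingError {θ : ℝ} (hθ : θ ≠ 0) (t : ℝ) (p : Polynomial ℤ) {k : ℤ}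
    (hk : k + p.natDegree ≤ 0) : ∃ n : ℤ,
      recurrence p (roundingError θ t) k = t * θ ^ k * Polynomial.aeval θ p - n := by
  obtain ⟨n, hn⟩ := exists_int_eq_recurrence p (fun j => round (t * θ ^ j)) k
  refine ⟨n, ?_⟩
  rw [hn, ← recurrence_mul_zpow p hθ, ← recurrence_sub]
  exact recurrence_congr p fun i hi => if_pos (by lia)

lemma exists_int_eq_recurrence_roundingError {θ : ℝ} (hθ : θ ≠ 0) (t : ℝ) {k : ℤ}
    (hk : k + (minpoly ℤ θ).natDegree ≤ 0) :
    ∃ n : ℤ, (n : ℝ) = recurrence (minpoly ℤ θ) (roundingError θ t) k := by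
  obtain ⟨n, hn⟩ := recurrence_roundingError hθ t (minpoly ℤ θ) hk
  exact ⟨-n, by rw [hn, minpoly.aeval]; simp⟩

/-- Halving `t` turns the argument into `π t θ^k`, where subtracting an integer from `t θ^k` changes
at most the sign of the cosine; hence the absolute values. -/
lemma hasProd_abs_cos_roundingError {θ : ℝ} (hθ : 1 < θ) (t : ℝ) :
    HasProd (fun k => |Real.cos (Real.pi * roundingError θ t k)|) |cosProduct θ (t / 2)| := by
  have hinj : Function.Injective fun j : ℕ => -(j : ℤ) := fun a b h => by simpa using h
  rw [← hinj.hasProd_iff]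
  · have h := (hasProd_cosProduct hθ (t / 2)).map (absHom : ℝ →*₀ ℝ) continuous_abs
    refine h.congr_fun fun j => ?_
    simp only [Function.comp_apply]
    rw [roundingError, if_pos (by simp), zpow_neg, zpow_natCast, ← inv_pow]
    have e : Real.pi * (t * θ⁻¹ ^ j - round (t * θ⁻¹ ^ j)) =
      2 * Real.pi * (t / 2 * θ⁻¹ ^ j) - round (t * θ⁻¹ ^ j) * Real.pi := by ring
    rw [e, Real.cos_sub_int_mul_pi, abs_mul, abs_zpow, abs_neg, abs_one, one_zpow, one_mul]
    rfl
  · intro k hk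
    have : 0 < k := by
      by_contra h
      exact hk ⟨(-k).toNat, by simp only; lia⟩
    rw [roundingError_of_pos _ _ this]
    simp

lemma HasProd.tendsto_prod_Icc_neg {f : ℤ → ℝ} {a : ℝ} (h : HasProd f a) :
    Tendsto (fun K : ℕ => ∏ k ∈ Finset.Icc (-(K : ℤ)) K, f k) atTop (𝓝 a) := by
  have h' : Tendsto (fun s : Finset ℤ => ∏ k ∈ s, f k) atTop (𝓝 a) := h
  exact h'.comp Finset.tendsto_Icc_neg

lemma le_prod_of_hasProd {ι : Type*} {f : ι → ℝ} {a : ℝ} (h : HasProd f a) (h0 : ∀ i, 0 ≤ f i)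
    (h1 : ∀ i, f i ≤ 1) (s : Finset ι) : a ≤ ∏ i ∈ s, f i := by
  classical
  refine le_of_tendsto h ?_
  filter_upwards [eventually_ge_atTop s] with t ht
  rw [← Finset.prod_sdiff ht]
  exact mul_le_of_le_one_left (Finset.prod_nonneg fun i _ => h0 i)
    (Finset.prod_le_one (fun i _ => h0 i) fun i _ => h1 i)

lemma abs_cos_pi_mul_le {δ x : ℝ} (hδ : 0 ≤ δ) (hδx : δ ≤ |x|) (hx : |x| ≤ 1 / 2) :
    |Real.cos (Real.pi * x)| ≤ Real.cos (Real.pi * δ) := by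
  have hpi := Real.pi_pos
  have e : Real.cos (Real.pi * x) = Real.cos (Real.pi * |x|) := by
    rw [← Real.cos_abs, abs_mul, abs_of_pos hpi]
  rw [e, abs_of_nonneg]
  · exact Real.cos_le_cos_of_nonneg_of_le_pi (by positivity) (by nlinarith) (by gcongr)
  · exact Real.cos_nonneg_of_neg_pi_div_two_le_of_le (by nlinarith [abs_nonneg x]) (by nlinarith)

/-- If the product is bounded below, then the recurrence fails boundedly often. -/
lemma IsPisot.exists_card_le_of_le_abs_cosProduct {θ : ℝ} (hθ : IsPisot θ) {c₀ : ℝ} (hc₀ : 0 < c₀) :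
    ∃ M : ℕ, ∀ t, c₀ ≤ |cosProduct θ (t / 2)| → ∀ F : Finset ℤ,
      (∀ k ∈ F, k + (minpoly ℤ θ).natDegree ≤ 0 ∧
        recurrence (minpoly ℤ θ) (roundingError θ t) k ≠ 0) → F.card ≤ M := by
  classical
  have h0 : θ ≠ 0 := by linarith [hθ.2.1]
  set d := (minpoly ℤ θ).natDegree with hd
  set S := ∑ i ∈ Finset.range (d + 1), |((minpoly ℤ θ).coeff i : ℝ)| with hS
  have hS0 : 0 ≤ S := Finset.sum_nonneg fun _ _ => abs_nonneg _
  -- Errors below `δ` make the recurrence an integer of modulus at most `S * δ < 1`, hence zero;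
  -- also `δ ≤ 1 / 2`.
  set δ : ℝ := 1 / (S + 2) with hδ
  have hδ0 : 0 < δ := by positivity
  have hδ1 : δ ≤ 1 / 2 := by
    rw [hδ]; exact one_div_le_one_div_of_le (by norm_num) (by linarith)
  set γ := Real.cos (Real.pi * δ) with hγ
  have hpi := Real.pi_pos
  have hγ0 : 0 ≤ γ := (abs_nonneg _).trans (abs_cos_pi_mul_le hδ0.le (x := δ)
    (by rw [abs_of_pos hδ0]) (by rw [abs_of_pos hδ0]; exact hδ1))
  have hγ1 : γ < 1 := by
    rw [hγ, ← Real.cos_zero]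
    exact Real.cos_lt_cos_of_nonneg_of_le_pi le_rfl (by nlinarith) (by positivity)
  obtain ⟨N, hN⟩ := exists_pow_lt_of_lt_one hc₀ hγ1
  refine ⟨N * (d + 1), fun t ht F hF => ?_⟩
  have hex : ∀ k ∈ F, ∃ i ∈ Finset.range (d + 1), δ ≤ |roundingError θ t (k + i)| := by
    intro k hk
    by_contra! hcon
    obtain ⟨n, hn⟩ := exists_int_eq_recurrence_roundingError h0 t (hF k hk).1
    have hle := abs_recurrence_le (minpoly ℤ θ) (ε := roundingError θ t) (k := k) (B := δ)
      fun i hi => (hcon i (by simp; lia)).le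
    rw [← hn, ← hd, ← hS] at hle
    have hlt : S * δ < 1 := by
      rw [hδ, mul_one_div, div_lt_one (by positivity)]; linarith
    have hn0 : |n| < 1 := by exact_mod_cast hle.trans_lt hlt
    refine (hF k hk).2 ?_
    rw [← hn, Int.abs_lt_one_iff.1 hn0, Int.cast_zero]
  -- `G` collects the large errors near `F`. Each costs a factor `γ < 1`, so there are at most `N`,
  -- and each element of `F` lies within `d` to the left of one of them.
  let G := (F ×ˢ Finset.range (d + 1)).image (fun x => x.1 + (x.2 : ℤ)) |>.filter
    fun k => δ ≤ |roundingError θ t k|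
  have hG : G.card ≤ N := by
    by_contra! hlt
    have h1 := le_prod_of_hasProd (hasProd_abs_cos_roundingError hθ.2.1 t) (fun _ => abs_nonneg _)
      (fun _ => Real.abs_cos_le_one _) G
    have h2 : ∏ k ∈ G, |Real.cos (Real.pi * roundingError θ t k)| ≤ ∏ _k ∈ G, γ :=
      Finset.prod_le_prod (fun _ _ => abs_nonneg _) fun k hk =>
        abs_cos_pi_mul_le hδ0.le (Finset.mem_filter.1 hk).2 (abs_roundingError_le _ _ _)
    rw [Finset.prod_const] at h2
    have h3 := pow_le_pow_of_le_one hγ0 hγ1.le hlt.le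
    linarith
  have hFG : F ⊆ (G ×ˢ Finset.range (d + 1)).image fun x => x.1 - (x.2 : ℤ) := by
    intro k hk
    obtain ⟨i, hi, hki⟩ := hex k hk
    refine Finset.mem_image.2 ⟨(k + i, i), Finset.mem_product.2 ⟨Finset.mem_filter.2
      ⟨Finset.mem_image.2 ⟨(k, i), Finset.mem_product.2 ⟨hk, hi⟩, rfl⟩, hki⟩, hi⟩, by simp⟩
  calc F.card ≤ (G ×ˢ Finset.range (d + 1)).card :=
        (Finset.card_le_card hFG).trans Finset.card_image_le
    _ = G.card * (d + 1) := by rw [Finset.card_product, Finset.card_range]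
    _ ≤ _ := Nat.mul_le_mul_right _ hG

/-- The list is padded with `0`, and the extra slot guarantees that `0` occurs: near the cut the
recurrence is not controlled, so the cut counts as a position. -/
lemma exists_enumeration {D : Set ℤ} {M : ℕ} (hD0 : ∀ k ∈ D, k ≤ 0)
    (hD : ∀ F : Finset ℤ, (∀ k ∈ F, k ∈ D) → F.card ≤ M) :
    ∃ p : Fin (M + 1) → ℤ, (∀ i, p i ≤ 0) ∧ (∃ i, p i = 0) ∧ ∀ k ∈ D, ∃ i, p i = k := by
  have hfin : D.Finite := by
    by_contra hinf
    obtain ⟨F, hF, hcard⟩ := Set.Infinite.exists_subset_card_eq hinf (M + 1)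
    have := hD F fun k hk => hF hk
    lia
  obtain ⟨F, rfl⟩ := hfin.exists_finset_coe
  have hcard : F.toList.length ≤ M := by
    rw [Finset.length_toList]; exact hD F fun k hk => hk
  refine ⟨fun i => F.toList.getD i 0, fun i => ?_, ⟨⟨M, by lia⟩, ?_⟩, fun k hk => ?_⟩
  · rcases lt_or_ge (i : ℕ) F.toList.length with h | h
    · simp only [List.getD_eq_getElem _ _ h]
      exact hD0 _ (Finset.mem_toList.1 (List.getElem_mem h))
    · simp only [List.getD_eq_default _ _ h, le_refl]
  · exact List.getD_eq_default _ _ hcard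
  · obtain ⟨j, hj, rfl⟩ := List.getElem_of_mem (Finset.mem_toList.2 hk)
    exact ⟨⟨j, by lia⟩, List.getD_eq_getElem _ _ hj⟩

lemma isModerate_sum_pow {ρ : ℝ} (h0 : 0 < ρ) (h1 : ρ < 1) {M : ℕ} (p : Fin M → ℤ) :
    IsModerate ρ fun k => ∑ i, ρ ^ (k - p i).natAbs := by
  refine ⟨fun k => by positivity, fun k => ?_, fun k => ?_⟩ <;>
  · rw [Finset.mul_sum]
    refine Finset.sum_le_sum fun i _ => ?_
    rw [← pow_succ']
    exact pow_le_pow_of_le_one h0.le h1.le (by lia)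

/-! ### Local limits and countability of the closure -/

lemma exists_finsupp_eq {f : ℤ → ℝ} (hf : ∀ k, ∃ n : ℤ, (n : ℝ) = f k)
    (hfin : {k | f k ≠ 0}.Finite) : ∃ σ : ℤ →₀ ℤ, ∀ k, f k = σ k := by
  choose σ hσ using hf
  refine ⟨Finsupp.onFinset hfin.toFinset σ fun k hk => ?_, fun k => (hσ k).symm⟩
  simpa [← hσ k] using hk

lemma exists_int_eq_of_tendsto {ι : Type*} {l : Filter ι} [l.NeBot] {f : ι → ℝ} {x : ℝ}
    (hx : Tendsto f l (𝓝 x)) (hf : ∀ᶠ n in l, ∃ j : ℤ, (j : ℝ) = f n) : ∃ j : ℤ, (j : ℝ) = x :=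
  Int.isClosedEmbedding_coe_real.isClosed_range.mem_of_tendsto hx hf

/-- Relative to `a`, each position is either constant along `U` or divergent, so it excludes at most
one `k`. This makes the integer data of a local limit finitely supported. -/
lemma Ultrafilter.finite_setOf_not_eventually_ne {ι : Type*} (U : Ultrafilter ι) {M : ℕ}
    (p : ι → Fin M → ℤ) (a : ι → ℤ) : {k : ℤ | ¬ ∀ᶠ n in U, ∀ i, p n i ≠ a n + k}.Finite := by
  have h (i : Fin M) : ∃ m : ℤ, ∀ k ≠ m, ∀ᶠ n in U, p n i ≠ a n + k := by
    rcases U.eventually_eq_or_forall_lt_abs (fun n => p n i - a n) with ⟨m, hm⟩ | h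
    · exact ⟨m, fun k hk => hm.mono fun n hn => by lia⟩
    · exact ⟨0, fun k _ => (h |k|).mono fun n hn h' => by
        rw [h', add_sub_cancel_left] at hn; exact lt_irrefl _ hn⟩
  choose m hm using h
  refine (Set.finite_range m).subset fun k hk => ?_
  by_contra hcon
  exact hk (eventually_all.2 fun i => hm i k fun h => hcon ⟨i, h.symm⟩)

/-- The possible local limits of the sequences of rounding errors. -/
def localLimits (θ : ℝ) (c : Polynomial ℤ) : Set (ℤ → ℝ) :=
  homoclinicSequences θ ∪ ⋃ m : ℤ, (fun ε k => ε (k + m)) '' boundarySequences θ c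

lemma IsPisot.countable_localLimits {θ : ℝ} (hθ : IsPisot θ) {c : Polynomial ℤ}
    (hc : c.natDegree < (minpoly ℤ θ).natDegree) (hc0 : Polynomial.aeval θ c ≠ 0) :
    (localLimits θ c).Countable :=
  hθ.countable_homoclinicSequences.union
    (Set.countable_iUnion fun _ => (hθ.countable_boundarySequences hc hc0).image _)

/-- Limits of finite products of two-sided cosine products of sequences in `E`. -/
def productLimits (E : Set (ℤ → ℝ)) : Set ℝ :=
  {x | ∃ (M : ℕ) (R : Finset (Fin M)) (e : Fin M → ℤ → ℝ), (∀ i, e i ∈ E) ∧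
    Tendsto (fun W : ℕ => ∏ c ∈ R, ∏ k ∈ Finset.Icc (-(W : ℤ)) W, |Real.cos (Real.pi * e c k)|)
      atTop (𝓝 x)}

lemma countable_productLimits {E : Set (ℤ → ℝ)} (hE : E.Countable) :
    (productLimits E).Countable := by
  have hsub : productLimits E ⊆ ⋃ (M : ℕ) (R : Finset (Fin M)),
      ⋃ e ∈ {e : Fin M → ℤ → ℝ | ∀ i, e i ∈ E}, {x | Tendsto (fun W : ℕ =>
        ∏ c ∈ R, ∏ k ∈ Finset.Icc (-(W : ℤ)) W, |Real.cos (Real.pi * e c k)|) atTop (𝓝 x)} := by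
    rintro x ⟨M, R, e, he, hx⟩
    simp only [Set.mem_iUnion]
    exact ⟨M, R, e, he, hx⟩
  refine (Set.countable_iUnion fun M => Set.countable_iUnion fun R =>
    (Set.countable_pi fun _ => hE).biUnion fun e _ => Set.Subsingleton.countable ?_).mono hsub
  exact fun x hx y hy => tendsto_nhds_unique hx hy

/-- A nonzero value occurs only at a listed position or within `d` of the cut, itself a listed
position. Dividing by `ρ ^ d` absorbs that distance. -/
lemma abs_recurrence_roundingError_le (θ t : ℝ) {ρ : ℝ} (h0 : 0 < ρ)
    (h1 : ρ < 1) {M : ℕ} {p : Fin M → ℤ} (hp0 : ∃ i, p i = 0)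
    (hp : ∀ k : ℤ, k + (minpoly ℤ θ).natDegree ≤ 0 →
      recurrence (minpoly ℤ θ) (roundingError θ t) k ≠ 0 → ∃ i, p i = k) (k : ℤ) :
    |recurrence (minpoly ℤ θ) (roundingError θ t) k| ≤
      ((∑ i ∈ Finset.range ((minpoly ℤ θ).natDegree + 1), |((minpoly ℤ θ).coeff i : ℝ)|) *
        (1 / 2) / ρ ^ (minpoly ℤ θ).natDegree) * ∑ i, ρ ^ (k - p i).natAbs := by
  set d := (minpoly ℤ θ).natDegree with hd
  set S := ∑ i ∈ Finset.range (d + 1), |((minpoly ℤ θ).coeff i : ℝ)| with hS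
  have hS0 : 0 ≤ S := Finset.sum_nonneg fun _ _ => abs_nonneg _
  have hle : |recurrence (minpoly ℤ θ) (roundingError θ t) k| ≤ S * (1 / 2) :=
    abs_recurrence_le _ fun _ _ => abs_roundingError_le _ _ _
  by_cases hk : recurrence (minpoly ℤ θ) (roundingError θ t) k = 0
  · rw [hk, abs_zero]; positivity
  obtain ⟨i, hi⟩ : ∃ i, (k - p i).natAbs ≤ d := by
    by_cases hkd : k + d ≤ 0
    · obtain ⟨i, hi⟩ := hp k hkd hk
      exact ⟨i, by rw [hi]; simp⟩
    · obtain ⟨i, hi⟩ := hp0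
      refine ⟨i, ?_⟩
      have : k ≤ 0 := by
        by_contra hpos
        refine hk ?_
        rw [recurrence_congr _ (η := fun _ => 0) fun j _ => roundingError_of_pos _ _ (by lia)]
        simp [recurrence]
      rw [hi]; lia
  have h2 : ρ ^ d ≤ ∑ i, ρ ^ (k - p i).natAbs :=
    (pow_le_pow_of_le_one h0.le h1.le hi).trans
      (Finset.single_le_sum (f := fun i => ρ ^ (k - p i).natAbs) (fun _ _ => by positivity)
        (Finset.mem_univ i))
  refine hle.trans ?_
  rw [div_mul_eq_mul_div, le_div_iff₀ (by positivity)]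
  exact mul_le_mul_of_nonneg_left h2 (by positivity)

lemma IsPisot.exists_abs_roundingError_le {θ : ℝ} (hθ : IsPisot θ) :
    ∃ A q : ℝ, 0 ≤ A ∧ 0 < q ∧ q < 1 ∧ ∀ (t : ℝ) (M : ℕ) (p : Fin M → ℤ), (∃ i, p i = 0) →
      (∀ k : ℤ, k + (minpoly ℤ θ).natDegree ≤ 0 →
        recurrence (minpoly ℤ θ) (roundingError θ t) k ≠ 0 → ∃ i, p i = k) →
      ∀ k, |roundingError θ t k| ≤ A * ∑ i, (q * q) ^ (k - p i).natAbs := by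
  have h0 : θ ≠ 0 := by linarith [hθ.2.1]
  obtain ⟨ρ, D, hρ0, hρ1, hD, H⟩ := hθ.exists_abs_le_of_abs_recurrence_le
  set A₀ := (∑ i ∈ Finset.range ((minpoly ℤ θ).natDegree + 1), |((minpoly ℤ θ).coeff i : ℝ)|) *
        (1 / 2) / ρ ^ (minpoly ℤ θ).natDegree with hA₀
  have hA : 0 ≤ A₀ := by positivity
  refine ⟨D * A₀, Real.sqrt ρ, by positivity, Real.sqrt_pos.2 hρ0,
    (Real.sqrt_lt' one_pos).2 (by simpa using hρ1), fun t M p hp0 hp k => ?_⟩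
  rw [Real.mul_self_sqrt hρ0.le, mul_assoc]
  exact H _ _ _ ((isModerate_sum_pow hρ0 hρ1 p).const_mul hA) (abs_roundingError_le θ t)
    (abs_recurrence_roundingError_le θ t hρ0 hρ1 hp0 hp) k

/-- Limits of shifted sequences of rounding errors are local limits. -/
lemma Ultrafilter.mem_localLimits {θ : ℝ} (hθ : θ ≠ 0) {c : Polynomial ℤ}
    (hc : c.natDegree < (minpoly ℤ θ).natDegree) {ι : Type*} (U : Ultrafilter ι) {t : ι → ℝ}
    (ht : ∀ n, ∃ j : ℤ, (j : ℝ) =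
      t n * θ ^ (-((minpoly ℤ θ).natDegree : ℤ)) * Polynomial.aeval θ c)
    {M : ℕ} {p : ι → Fin M → ℤ} (hp : ∀ n, ∀ k : ℤ, k + (minpoly ℤ θ).natDegree ≤ 0 →
      recurrence (minpoly ℤ θ) (roundingError θ (t n)) k ≠ 0 → ∃ i, p n i = k)
    {a : ι → ℤ} (ha : ∀ n, a n ≤ 0) {e : ℤ → ℝ}
    (he : ∀ k, Tendsto (fun n => roundingError θ (t n) (a n + k)) U (𝓝 (e k))) :
    e ∈ localLimits θ c := by
  set d := (minpoly ℤ θ).natDegree with hd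
  have hb (k : ℤ) : |e k| ≤ 1 / 2 :=
    le_of_tendsto (he k).abs (Eventually.of_forall fun n => abs_roundingError_le _ _ _)
  have hrec (k : ℤ) : Tendsto
      (fun n => recurrence (minpoly ℤ θ) (roundingError θ (t n)) (a n + k)) U
      (𝓝 (recurrence (minpoly ℤ θ) e k)) := by
    simpa only [recurrence_comp_add] using tendsto_recurrence (minpoly ℤ θ) (k := k) he
  have hint (k : ℤ) (hk : ∀ᶠ n in U, a n + k + d ≤ 0) :
      ∃ j : ℤ, (j : ℝ) = recurrence (minpoly ℤ θ) e k :=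
    exists_int_eq_of_tendsto (hrec k)
      (hk.mono fun n hn => exists_int_eq_recurrence_roundingError hθ (t n) hn)
  have hzero (k : ℤ) (hk : ∀ᶠ n in U, a n + k + d ≤ 0) (hk' : ∀ᶠ n in U, ∀ i, p n i ≠ a n + k) :
      recurrence (minpoly ℤ θ) e k = 0 := by
    refine tendsto_nhds_unique (hrec k) (tendsto_const_nhds.congr' ?_)
    filter_upwards [hk, hk'] with n h1 h2
    by_contra hne
    obtain ⟨i, hi⟩ := hp n _ h1 (Ne.symm hne)
    exact h2 i hi
  have hfin := U.finite_setOf_not_eventually_ne p a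
  -- Either the centre stays at a fixed distance from the cut, giving a boundary sequence after a
  -- shift by `m`, or it drifts to `-∞` and the limit satisfies a two-sided recurrence.
  rcases U.eventually_eq_or_forall_lt_abs a with ⟨m, hm⟩ | hdiv
  · right
    refine Set.mem_iUnion.2 ⟨m, fun k => e (k - m), ⟨fun k => hb _, fun k hk => ?_, ?_, ?_⟩,
      by ext k; simp⟩
    · refine tendsto_nhds_unique (he (k - m)) (tendsto_const_nhds.congr' ?_)
      filter_upwards [hm] with n hn
      rw [hn, add_sub_cancel, roundingError_of_pos _ _ hk]
    · have e1 (k : ℤ) : recurrence (minpoly ℤ θ) (fun k => e (k - m)) k =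
          recurrence (minpoly ℤ θ) e (k - m) := by
        have := recurrence_comp_add (minpoly ℤ θ) e (-m) k
        simpa only [neg_add_eq_sub] using this
      have hev (k : ℤ) (hk : k + d ≤ 0) : ∀ᶠ n in U, a n + (k - m) + d ≤ 0 :=
        hm.mono fun n hn => by lia
      let f : ℤ → ℝ := fun k =>
        if k + d ≤ 0 then recurrence (minpoly ℤ θ) (fun k => e (k - m)) k else 0
      have hf (k : ℤ) : ∃ j : ℤ, (j : ℝ) = f k := by
        by_cases hk : k + d ≤ 0
        · simp only [f, if_pos hk, e1]; exact hint _ (hev k hk)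
        · exact ⟨0, by simp [f, if_neg hk]⟩
      have hffin : {k | f k ≠ 0}.Finite := by
        refine (hfin.image fun k => k + m).subset fun k hk => ⟨k - m, fun hne => hk ?_, by simp⟩
        by_cases hkd : k + d ≤ 0
        · simp only [f, if_pos hkd, e1]; exact hzero _ (hev k hkd) hne
        · simp [f, if_neg hkd]
      obtain ⟨σ, hσ⟩ := exists_finsupp_eq hf hffin
      exact ⟨σ, fun k hk => by rw [← hσ k]; exact (if_pos hk).symm⟩
    -- By `ht` the main term `t θ^{-d} c(θ)` is an integer before the limit, so the recurrence for
    -- `c` takes integer values, and integrality survives the limit.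
    · have hlim : Tendsto (fun n => recurrence c (roundingError θ (t n)) (-(d : ℤ))) U
          (𝓝 (recurrence c (fun k => e (k - m)) (-(d : ℤ)))) := by
        refine tendsto_recurrence c fun j => ((he (j - m)).congr' ?_)
        filter_upwards [hm] with n hn
        rw [hn, add_sub_cancel]
      obtain ⟨j, hj⟩ := exists_int_eq_of_tendsto hlim (Eventually.of_forall fun n => by
        obtain ⟨i, hi⟩ := recurrence_roundingError hθ (t n) c (k := -(d : ℤ)) (by lia)
        obtain ⟨l, hl⟩ := ht n
        exact ⟨l - i, by rw [hi, ← hl]; push_cast; ring⟩)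
      exact ⟨j, hj.symm⟩
  · left
    have hev (k : ℤ) : ∀ᶠ n in U, a n + k + d ≤ 0 :=
      (hdiv (k + d)).mono fun n hn => by
        have := ha n
        rw [abs_of_nonpos this] at hn
        lia
    obtain ⟨σ, hσ⟩ := exists_finsupp_eq (f := recurrence (minpoly ℤ θ) e)
      (fun k => hint k (hev k)) (hfin.subset fun k hk hne => hk (hzero k (hev k) hne))
    exact ⟨hb, σ, hσ⟩

lemma exists_ultrafilter_tendsto_of_mem_closure_range {ι X : Type*} [TopologicalSpace X]
    {f : ι → X} {x : X} (hx : x ∈ closure (Set.range f)) :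
    ∃ U : Ultrafilter ι, Tendsto f U (𝓝 x) := by
  have : (comap f (𝓝 x)).NeBot := comap_neBot_iff.2 fun s hs => by
    obtain ⟨_, hy, n, rfl⟩ := mem_closure_iff_nhds.1 hx s hs
    exact ⟨n, hy⟩
  exact ⟨Ultrafilter.of _, tendsto_iff_comap.2 (Ultrafilter.of_le _)⟩

lemma IsPisot.countable_closure_cosProductSet {θ : ℝ} (hθ : IsPisot θ) {r : ℝ} (hr : r ≠ 0)
    (hrθ : r ∈ ℚ⟮θ⟯) : (closure (cosProductSet θ r)).Countable := by
  have h0 : θ ≠ 0 := by linarith [hθ.2.1]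
  -- The choice `c(θ) = q θ^d / r` makes `t θ^{-d} c(θ) = 2 n q` an integer for `t = 2 r n`.
  obtain ⟨q, c, hq, hc, hcθ⟩ := exists_int_polynomial_aeval_eq hθ.1 (y :=
    θ ^ (minpoly ℤ θ).natDegree * r⁻¹)
    (mul_mem (pow_mem (IntermediateField.mem_adjoin_simple_self ℚ θ) _) (inv_mem hrθ))
  have hc0 : Polynomial.aeval θ c ≠ 0 := by rw [hcθ]; positivity
  have hV := countable_productLimits (hθ.countable_localLimits hc hc0)
  refine (((Set.countable_singleton 0).union hV).union (hV.image Neg.neg)).mono fun z hz => ?_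
  rcases eq_or_ne z 0 with rfl | hz0
  · exact Or.inl (Or.inl rfl)
  suffices h : |z| ∈ productLimits (localLimits θ c) by
    rcases abs_choice z with h' | h'
    · exact Or.inl (Or.inr (h' ▸ h))
    · exact Or.inr ⟨|z|, h, by rw [h', neg_neg]⟩
  -- Near a nonzero `z` only those `n` matter whose product has modulus at least `|z| / 2`, which
  -- bounds the number of positions uniformly.
  set c₀ := |z| / 2 with hc₀
  have hc₀0 : 0 < c₀ := by have := abs_pos.2 hz0; positivity
  let ι := {n : ℤ // c₀ ≤ |cosProduct θ (r * n)|}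
  have hz' : z ∈ closure (Set.range fun n : ι => cosProduct θ (r * (n.1 : ℝ))) := by
    rw [mem_closure_iff_nhds] at hz ⊢
    intro s hs
    have hev : {x : ℝ | c₀ < |x|} ∈ 𝓝 z :=
      (isOpen_lt continuous_const continuous_abs).mem_nhds (by
        have := abs_pos.2 hz0
        simp only [hc₀, Set.mem_ofPred_eq]; linarith)
    obtain ⟨_, ⟨hy1, hy2⟩, n, rfl⟩ := hz _ (inter_mem hs hev)
    exact ⟨_, hy1, ⟨n, le_of_lt hy2⟩, rfl⟩
  obtain ⟨U, hU⟩ := exists_ultrafilter_tendsto_of_mem_closure_range hz'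
  let t : ι → ℝ := fun n => 2 * (r * (n.1 : ℝ))
  have ht2 (n : ι) : t n / 2 = r * (n.1 : ℝ) := by simp [t]
  obtain ⟨M, hM⟩ := hθ.exists_card_le_of_le_abs_cosProduct hc₀0
  have hexp (n : ι) := exists_enumeration (M := M)
    (D := {k : ℤ | k + (minpoly ℤ θ).natDegree ≤ 0 ∧
      recurrence (minpoly ℤ θ) (roundingError θ (t n)) k ≠ 0})
    (fun k hk => by have := hk.1; lia) (hM (t n) (by rw [ht2]; exact n.2))
  choose p hp1 hp2 hp3 using hexp
  obtain ⟨A, q', hA, hq0, hq1, hbound⟩ := hθ.exists_abs_roundingError_le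
  have hlim (i : Fin (M + 1)) (k : ℤ) :=
    U.exists_tendsto_of_abs_le (fun n => abs_roundingError_le θ (t n) (p n i + k))
  choose e he using hlim
  obtain ⟨R, hR⟩ := U.exists_tendsto_prod_windows p (fun n => roundingError θ (t n)) hA hq0 hq1
    (Eventually.of_forall fun n => hbound (t n) _ (p n) (hp2 n) fun k h1 h2 => hp3 n k ⟨h1, h2⟩)
    (fun n => |cosProduct θ (t n / 2)|)
    (fun n => (hasProd_abs_cos_roundingError hθ.2.1 (t n)).tendsto_prod_Icc_neg)
    (z := |z|) (by simp only [ht2]; exact hU.abs) he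
  refine ⟨M + 1, R, e, fun i => U.mem_localLimits h0 hc (t := t) (fun n => ⟨2 * n.1 * q, ?_⟩)
    (fun n k h1 h2 => hp3 n k ⟨h1, h2⟩) (fun n => hp1 n i) (he i), hR⟩
  rw [hcθ, zpow_neg, zpow_natCast]
  simp only [t]
  push_cast
  field_simp

theorem theorem3 (θ : ℝ) (hθ : IsPisot θ) (hθ2 : θ ≠ 2) (r : ℝ) (hr : 0 < r)
    (hrθ : r ∈ ℚ⟮θ⟯) (n : ℕ) (hn : 1 ≤ n) :
    (iteratedDerivedSet n (fourierCoeffSet (bernoulliConvolution θ) r)).Countable ∧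
      (iteratedDerivedSet n (fourierCoeffSet (bernoulliConvolution θ) r)).Infinite := by
  rw [fourierCoeffSet_bernoulliConvolution hθ.2.1]
  refine ⟨?_, infinite_iteratedDerivedSet_of_nonempty_succ ?_⟩
  · refine Set.Countable.mono (iteratedDerivedSet_subset_closure n _) ?_
    rw [Complex.isometry_ofReal.isClosedEmbedding.closure_image_eq]
    exact (hθ.countable_closure_cosProductSet hr.ne' hrθ).image _
  · exact ((hθ.nonempty_iteratedDerivedSet hθ2 hr.ne' hrθ n).image _).mono
      (image_iteratedDerivedSet_subset Complex.continuous_ofReal Complex.ofReal_injective _ _)
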